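/- Let $(X,d,\mu)$ be a complete metric space with a Borel regular measure $\mu$ that is doubling, i.e. there is a constant $C_D$ with $0<\mu(B(z,2r))\le C_D\,\mu(B(z,r))<\infty$ for all $z\in X$, $r>0$. For $A\subset X$ let $$\mathcal H(A)=\lim_{\delta\to0^+}\inf\Big\{\sum_i\frac{\mu(B_i)}{\mathrm{rad}(B_i)}:\ (B_i)\text{ a countable family of balls},\ \mathrm{rad}(B_i)<\delta,\ A\subset\bigcup_iB_i\Big\}$$ be the co-dimension $1$ Hausdorff measure. Let $\Omega\subset X$ be a bounded domain whose boundary is Ahlfors co-dimension $1$ regular: there is $C\ge1$ such that for all $x\in\partial\Omega$ and $0<r\le\operatorname{diam}\Omega$, $$C^{-1}\frac{\mu(B(x,r))}{r}\le\mathcal H(B(x,r)\cap\partial\Omega)\le C\,\frac{\mu(B(x,r))}{r}.$$ Fix $R>0$. Let $B^0_{1,1}(\partial\Omega)$ be the space of (classes of) functions $f$ on $\partial\Omega$ with $$\|f\|_{B^0_{1,1}(\partial\Omega)}=\|f\|_{L^1(\partial\Omega,\mathcal H)}+\int_0^R\int_{\partial\Omega}\frac{1}{\mathcal H(B(x,t)\cap\partial\Omega)}\int_{B(x,t)\cap\partial\Omega}|f(y)-f(x)|\,d\mathcal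 H(y)\,d\mathcal H(x)\,\frac{dt}{t}<\infty.$$ Let $BV(\Omega)$ be the space of $u\in L^1(\Omega,\mu)$ with $\|u\|_{BV(\Omega)}=\|u\|_{L^1(\Omega)}+\|Du\|(\Omega)<\infty$, where $$\|Du\|(\Omega)=\inf\Big\{\liminf_{i\to\infty}I(u_i:\Omega):\ u_i\text{ locally Lipschitz in }\Omega,\ u_i\to u\text{ in }L^1(\Omega)\Big\},$$ and $I(v:\Omega)$ is the infimum of $\int_\Omega g\,d\mu$ over all Borel functions $g:\Omega\to[0,\infty]$ that are upper gradients of $v$ in $\Omega$, i.e. $|v(\gamma(b))-v(\gamma(a))|\le\int_\gamma g\,ds$ for all rectifiable curves $\gamma:[a,b]\to\Omega$. Then there is a bounded linear operator $E:B^0_{1,1}(\partial\Omega)\to BV(\Omega)$, that is, a linear map with $\|Ef\|_{BV(\Omega)}\le C'\|f\|_{B^0_{1,1}(\partial\Omega)}$ for a constant $C'$ independent of $f$, such that $T\circ E$ is the identity on $B^0_{1,1}(\partial\Omega)$, where $T$ is the trace: for every $f\in B^0_{1,1}(\partial\Omega)$ and for $\mathcal H$-almost every $z\in\partial\Omega$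 the trace of $Ef$ at $z$ exists and equals $f(z)$, i.e. $$\lim_{r\to0^+}\frac{1}{\mu(B(z,r)\cap\Omega)}\int_{B(z,r)\cap\Omega}|Ef(y)-f(z)|\,d\mu(y)=0.$$ No Poincaré inequality is assumed. -/

import Mathlib

open MeasureTheory Set Filter Topology
open scoped ENNReal NNReal

namespace MetricBV

noncomputable section

/-! ### Doubling measures -/

/-- `μ` is doubling: there is a constant `C` such that
`0 < μ(B(z,2r)) ≤ C μ(B(z,r)) < ∞` for every `z` and every `r > 0`. -/
def IsDoubling {X : Type*} [MetricSpace X] [MeasurableSpace X] (μ : Measure X) : Prop :=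
  ∃ C : ℝ≥0, ∀ (z : X) (r : ℝ), 0 < r →
    0 < μ (Metric.ball z (2 * r)) ∧
    μ (Metric.ball z (2 * r)) ≤ C * μ (Metric.ball z r) ∧
    C * μ (Metric.ball z r) < ∞

/-! ### The co-dimension 1 Hausdorff measure -/

section Hausdorff

variable {X : Type*} [MetricSpace X] [MeasurableSpace X]

/-- A ball is recorded as a pair (centre, radius). `IsBallCover δ A t` says that `t` is an at most
countable (possibly finite) collection of balls of radii in `(0, δ)` which covers `A`. -/
def IsBallCover (δ : ℝ) (A : Set X) (t : Set (X × ℝ)) : Prop :=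
  t.Countable ∧ (∀ b ∈ t, 0 < b.2 ∧ b.2 < δ) ∧ A ⊆ ⋃ b ∈ t, Metric.ball b.1 b.2

/-- The weight `μ(B) / rad(B)` of a ball. -/
def ballWeight (μ : Measure X) (b : X × ℝ) : ℝ≥0∞ :=
  μ (Metric.ball b.1 b.2) / ENNReal.ofReal b.2

/-- The infimum of `∑ μ(B_i) / rad(B_i)` over all countable covers of `A` by balls of radius less
than `δ`. -/
def codimOneContent (μ : Measure X) (δ : ℝ) (A : Set X) : ℝ≥0∞ :=
  ⨅ (t : Set (X × ℝ)) (_ : IsBallCover δ A t), ∑' b : t, ballWeight μ (b : X × ℝ)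

lemma codimOneContent_anti (μ : Measure X) (A : Set X) {δ δ' : ℝ} (h : δ ≤ δ') :
    codimOneContent μ δ' A ≤ codimOneContent μ δ A :=
  le_iInf₂ fun t ht =>
    iInf₂_le t ⟨ht.1, fun b hb => ⟨(ht.2.1 b hb).1, (ht.2.1 b hb).2.trans_le h⟩, ht.2.2⟩

/-- The content at a fixed scale, as an outer measure. -/
def codimOnePre (μ : Measure X) (δ : ℝ) : OuterMeasure X where
  measureOf := codimOneContent μ δ
  empty := by
    refine le_antisymm ?_ (by simp)
    refine (iInf₂_le (∅ : Set (X × ℝ)) ⟨countable_empty, by simp, by simp⟩).trans ?_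
    simp
  mono := fun hst => le_iInf₂ fun t ht => iInf₂_le t ⟨ht.1, ht.2.1, hst.trans ht.2.2⟩
  iUnion_nat := by
    intro s _
    refine ENNReal.le_of_forall_pos_le_add fun ε hε htop => ?_
    obtain ⟨ε', hε'pos, hε'⟩ :=
      ENNReal.exists_pos_sum_of_countable (ENNReal.coe_pos.2 hε).ne' ℕ
    have hfin : ∀ n, codimOneContent μ δ (s n) ≠ ∞ := fun n => ENNReal.ne_top_of_tsum_ne_top htop.ne n
    have hex : ∀ n, ∃ t : Set (X × ℝ), IsBallCover δ (s n) t ∧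
        ∑' b : t, ballWeight μ (b : X × ℝ) ≤ codimOneContent μ δ (s n) + ε' n := by
      intro n
      have hlt : codimOneContent μ δ (s n) < codimOneContent μ δ (s n) + ε' n :=
        ENNReal.lt_add_right (hfin n) (ENNReal.coe_pos.2 (hε'pos n)).ne'
      rw [codimOneContent, iInf_lt_iff] at hlt
      obtain ⟨t, ht⟩ := hlt
      obtain ⟨hc, ht⟩ := iInf_lt_iff.1 ht
      exact ⟨t, hc, ht.le⟩
    choose t ht hsum using hex
    have hcov : IsBallCover δ (⋃ n, s n) (⋃ n, t n) := by
      refine ⟨countable_iUnion fun n => (ht n).1, ?_, ?_⟩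
      · intro b hb
        obtain ⟨n, hn⟩ := mem_iUnion.1 hb
        exact (ht n).2.1 b hn
      · intro x hx
        obtain ⟨n, hn⟩ := mem_iUnion.1 hx
        obtain ⟨b, hb, hxb⟩ := mem_iUnion₂.1 ((ht n).2.2 hn)
        exact mem_iUnion₂.2 ⟨b, mem_iUnion.2 ⟨n, hb⟩, hxb⟩
    calc codimOneContent μ δ (⋃ n, s n)
        ≤ ∑' b : ⋃ n, t n, ballWeight μ (b : X × ℝ) := iInf₂_le _ hcov
      _ ≤ ∑' n, ∑' b : t n, ballWeight μ (b : X × ℝ) := ENNReal.tsum_iUnion_le_tsum _ _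
      _ ≤ ∑' n, (codimOneContent μ δ (s n) + ε' n) := ENNReal.tsum_le_tsum hsum
      _ = ∑' n, codimOneContent μ δ (s n) + ∑' n, (ε' n : ℝ≥0∞) := ENNReal.tsum_add
      _ ≤ ∑' n, codimOneContent μ δ (s n) + ε := by gcongr

/-- The co-dimension 1 Hausdorff outer measure: the limit as `δ → 0⁺` of the contents at scale
`δ`, which is their supremum since they increase as `δ` decreases. -/
def codimOneOuter (μ : Measure X) : OuterMeasure X :=
  ⨆ (δ : ℝ) (_ : 0 < δ), codimOnePre μ δ

lemma codimOneOuter_apply (μ : Measure X) (A : Set X) :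
    codimOneOuter μ A = ⨆ (δ : ℝ) (_ : 0 < δ), codimOneContent μ δ A := by
  simp only [codimOneOuter, OuterMeasure.iSup_apply]
  rfl

lemma tendsto_codimOneContent (μ : Measure X) (A : Set X) :
    Tendsto (fun δ => codimOneContent μ δ A) (𝓝[>] 0) (𝓝 (codimOneOuter μ A)) := by
  rw [codimOneOuter_apply]
  refine tendsto_order.2 ⟨fun a ha => ?_, fun a ha => ?_⟩
  · obtain ⟨δ, hδ⟩ := lt_iSup_iff.1 ha
    obtain ⟨hpos, hδ⟩ := lt_iSup_iff.1 hδ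
    filter_upwards [Ioc_mem_nhdsGT hpos] with δ' hδ'
    exact hδ.trans_le (codimOneContent_anti μ A hδ'.2)
  · filter_upwards [self_mem_nhdsWithin] with δ hδ
    exact lt_of_le_of_lt (le_iSup₂ (f := fun (δ : ℝ) (_ : 0 < δ) => codimOneContent μ δ A) δ hδ) ha

lemma codimOneOuter_isMetric (μ : Measure X) : (codimOneOuter μ).IsMetric := by
  rintro s t ⟨r, r0, hr⟩
  refine le_antisymm (measure_union_le _ _) ?_
  obtain ⟨ρ, hρ0, hρr⟩ : ∃ ρ : ℝ, 0 < ρ ∧ ENNReal.ofReal (2 * ρ) ≤ r := by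
    obtain ⟨q, hq0, hqr⟩ := ENNReal.lt_iff_exists_nnreal_btwn.1 (pos_iff_ne_zero.2 r0)
    have hq0' : 0 < q := by exact_mod_cast hq0
    refine ⟨(q : ℝ) / 2, by positivity, ?_⟩
    have : 2 * ((q : ℝ) / 2) = q := by ring
    rw [this, ENNReal.ofReal_coe_nnreal]
    exact hqr.le
  refine le_of_tendsto_of_tendsto
    ((tendsto_codimOneContent μ s).add (tendsto_codimOneContent μ t))
    (tendsto_codimOneContent μ (s ∪ t)) ?_
  filter_upwards [Ioc_mem_nhdsGT hρ0] with δ hδ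
  refine le_iInf₂ fun c hc => ?_
  have key : ∀ u : Set X, u ⊆ s ∪ t →
      IsBallCover δ u {b ∈ c | (Metric.ball b.1 b.2 ∩ u).Nonempty} := by
    intro u hu
    refine ⟨hc.1.mono (sep_subset _ _), fun b hb => hc.2.1 b hb.1, fun x hx => ?_⟩
    obtain ⟨b, hb, hxb⟩ := mem_iUnion₂.1 (hc.2.2 (hu hx))
    exact mem_iUnion₂.2 ⟨b, ⟨hb, x, hxb, hx⟩, hxb⟩
  have hdisj : Disjoint {b ∈ c | (Metric.ball b.1 b.2 ∩ s).Nonempty}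
      {b ∈ c | (Metric.ball b.1 b.2 ∩ t).Nonempty} := by
    rw [Set.disjoint_left]
    rintro b ⟨hb, x, hxb, hxs⟩ ⟨-, y, hyb, hyt⟩
    have h1 : dist x y < 2 * ρ := by
      have := dist_triangle_right x y b.1
      have h2 := (hc.2.1 b hb).2
      have h3 := hδ.2
      rw [Metric.mem_ball] at hxb hyb
      linarith
    have h2 : edist x y < ENNReal.ofReal (2 * ρ) := by
      rw [edist_dist]
      exact (ENNReal.ofReal_lt_ofReal_iff (by positivity)).2 h1
    exact absurd ((hρr.trans (hr x hxs y hyt))) (not_le.2 h2)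
  calc codimOneContent μ δ s + codimOneContent μ δ t
      ≤ ∑' b : {b ∈ c | (Metric.ball b.1 b.2 ∩ s).Nonempty}, ballWeight μ (b : X × ℝ)
        + ∑' b : {b ∈ c | (Metric.ball b.1 b.2 ∩ t).Nonempty}, ballWeight μ (b : X × ℝ) :=
        add_le_add (iInf₂_le _ (key s subset_union_left)) (iInf₂_le _ (key t subset_union_right))
    _ = ∑' b : ({b ∈ c | (Metric.ball b.1 b.2 ∩ s).Nonempty} ∪
          {b ∈ c | (Metric.ball b.1 b.2 ∩ t).Nonempty} : Set (X × ℝ)),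
          ballWeight μ (b : X × ℝ) :=
        (ENNReal.summable.tsum_union_disjoint hdisj ENNReal.summable).symm
    _ ≤ ∑' b : c, ballWeight μ (b : X × ℝ) :=
        ENNReal.tsum_mono_subtype _ (union_subset (sep_subset _ _) (sep_subset _ _))

/-- The co-dimension 1 Hausdorff measure `ℋ` associated with `μ`, as a Borel measure. -/
def codimOneHausdorff [BorelSpace X] (μ : Measure X) : Measure X :=
  (codimOneOuter μ).toMeasure (codimOneOuter_isMetric μ).le_caratheodory

lemma codimOneHausdorff_apply [BorelSpace X] (μ : Measure X) {A : Set X} (hA : MeasurableSet A) :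
    codimOneHausdorff μ A = ⨆ (δ : ℝ) (_ : 0 < δ), codimOneContent μ δ A := by
  rw [codimOneHausdorff, toMeasure_apply _ _ hA, codimOneOuter_apply]

/-- The restriction of `ℋ` to the topological boundary of `Ω`, as a measure on the metric space
`∂Ω`. -/
def boundaryMeasure [BorelSpace X] (μ : Measure X) (Ω : Set X) : Measure (frontier Ω) :=
  (codimOneHausdorff μ).comap Subtype.val

/-- The restriction of `μ` to `Ω`, as a measure on the metric space `Ω`. -/
def domainMeasure (μ : Measure X) (Ω : Set X) : Measure Ω :=
  μ.comap Subtype.val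

/-- Ahlfors co-dimension 1 regularity of `∂Ω`: for some `C ≥ 1`,
`C⁻¹ μ(B(x,r))/r ≤ ℋ(B(x,r) ∩ ∂Ω) ≤ C μ(B(x,r))/r` for all `x ∈ ∂Ω`, `0 < r ≤ diam Ω`. -/
def IsCodimOneAhlforsRegular [BorelSpace X] (μ : Measure X) (Ω : Set X) : Prop :=
  ∃ C : ℝ≥0, 1 ≤ C ∧ ∀ x ∈ frontier Ω, ∀ r : ℝ, 0 < r → r ≤ Metric.diam Ω →
    (C : ℝ≥0∞)⁻¹ * (μ (Metric.ball x r) / ENNReal.ofReal r) ≤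
      codimOneHausdorff μ (Metric.ball x r ∩ frontier Ω) ∧
    codimOneHausdorff μ (Metric.ball x r ∩ frontier Ω) ≤
      C * (μ (Metric.ball x r) / ENNReal.ofReal r)

end Hausdorff

/-! ### Besov spaces -/

section Besov

variable {Z : Type*} [MetricSpace Z] [MeasurableSpace Z]

/-- The Besov energy
`∫_0^R ∫_Z ⨍_{B(x,t)} |u(y) - u(x)| dν(y) dν(x) dt / t^(1+θ)`. -/
def besovEnergy (ν : Measure Z) (θ R : ℝ) (u : Z → ℝ) : ℝ≥0∞ :=
  ∫⁻ t in Ioo (0 : ℝ) R,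
    (∫⁻ x, ⨍⁻ y in Metric.ball x t, ‖u y - u x‖ₑ ∂ν ∂ν) / ENNReal.ofReal (t ^ (1 + θ))

/-- The norm of the Besov space `B^θ_{1,1}(Z)`, with values in `[0,∞]`. -/
def besovNorm (ν : Measure Z) (θ R : ℝ) (u : Z → ℝ) : ℝ≥0∞ :=
  eLpNorm u 1 ν + besovEnergy ν θ R u

/-- The Besov space `B^θ_{1,1}(Z)`: the (classes of) functions of finite Besov norm. -/
def besovSpace (ν : Measure Z) (θ R : ℝ) : Set (Lp ℝ 1 ν) :=
  {u | besovNorm ν θ R u < ∞}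

end Besov

/-! ### Functions of bounded variation -/

section BV

variable {Y : Type*} [MetricSpace Y]

/-- The line integral `∫_γ g ds` of `g ≥ 0` along a rectifiable curve `γ : [a,b] → Y`, that is,
the integral of `g` over `[0, length γ]` along the arc-length parametrization of `γ`. -/
def lineIntegral (g : Y → ℝ≥0∞) (γ : ℝ → Y) (a b : ℝ) : ℝ≥0∞ :=
  ∫⁻ s in Icc (0 : ℝ) (eVariationOn γ (Icc a b)).toReal,
    g (naturalParameterization γ (Icc a b) a s)

/-- The Borel function `g : Y → [0,∞]` is an upper gradient of the real-valued function `u`: the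
inequality `|u(γ(b)) - u(γ(a))| ≤ ∫_γ g ds` holds for all rectifiable curves `γ : [a,b] → Y`. -/
def IsUpperGradient [MeasurableSpace Y] (g : Y → ℝ≥0∞) (u : Y → ℝ) : Prop :=
  Measurable g ∧ ∀ (a b : ℝ) (γ : ℝ → Y), a ≤ b → ContinuousOn γ (Icc a b) →
    BoundedVariationOn γ (Icc a b) → ‖u (γ b) - u (γ a)‖ₑ ≤ lineIntegral g γ a b

variable [MeasurableSpace Y]

/-- `I(u : Y)`, the infimum of `∫_Y g dμ` over all upper gradients `g` of `u` in `Y`. -/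
def upperGradientEnergy (μ : Measure Y) (u : Y → ℝ) : ℝ≥0∞ :=
  ⨅ (g : Y → ℝ≥0∞) (_ : IsUpperGradient g u), ∫⁻ x, g x ∂μ

/-- The total variation `‖Du‖(Y)`: the infimum of `liminf I(u_i : Y)` over all sequences of locally
Lipschitz functions `u_i` that converge to `u` in `L¹(Y)`. -/
def totalVariation (μ : Measure Y) (u : Y → ℝ) : ℝ≥0∞ :=
  ⨅ (v : ℕ → Y → ℝ) (_ : ∀ i, LocallyLipschitz (v i) ∧ MemLp (v i) 1 μ)
    (_ : Tendsto (fun i => eLpNorm (v i - u) 1 μ) atTop (𝓝 0)),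
    liminf (fun i => upperGradientEnergy μ (v i)) atTop

/-- The norm `‖u‖_{L¹(Y)} + ‖Du‖(Y)` of `BV(Y)`, with values in `[0,∞]`. -/
def bvNorm (μ : Measure Y) (u : Y → ℝ) : ℝ≥0∞ :=
  eLpNorm u 1 μ + totalVariation μ u

/-- The space `BV(Y)`: the (classes of) integrable functions of finite total variation. -/
def bvSpace (μ : Measure Y) : Set (Lp ℝ 1 μ) :=
  {u | totalVariation μ u < ∞}

end BV

/-! ### Traces -/

section Trace

variable {X : Type*} [MetricSpace X] [MeasurableSpace X]

/-- The trace of `u : Ω → ℝ` at the boundary point `z` exists and equals `c`: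
`⨍_{B(z,r) ∩ Ω} |u - c| dμ → 0` as `r → 0⁺`. -/
def HasTraceAt (μ : Measure X) (Ω : Set X) (u : Ω → ℝ) (z : X) (c : ℝ) : Prop :=
  Tendsto (fun r : ℝ => ⨍⁻ y in (Subtype.val ⁻¹' Metric.ball z r : Set Ω), ‖u y - c‖ₑ
    ∂(domainMeasure μ Ω)) (𝓝[>] 0) (𝓝 0)

/-- `T u = f`: the trace of `u` exists and equals `f(z)` at `ℋ`-almost every `z ∈ ∂Ω`. -/
def HasTrace [BorelSpace X] (μ : Measure X) (Ω : Set X) (u : Ω → ℝ) (f : frontier Ω → ℝ) : Prop :=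
  ∀ᵐ z : frontier Ω ∂(boundaryMeasure μ Ω), HasTraceAt μ Ω u (z : X) (f z)

end Trace

end

end MetricBV

namespace MetricBV

/-! ### Arc-length parametrizations and upper gradients -/

/-! The datum f is smoothed at the scales s_k = s_0/2^k by averaging against Lipschitz kernels. This
gives functions f_k on all of X (`smoothing`). With f_{-1} = 0, the extension is Ef = ∑ η_k (f_k -
f_{k-1}), where η_k is 1 at depth at most ρ_k/2 and 0 from depth ρ_k on (`layeredExtension`). Inside
Ω the sum is locally finite, so Ef is locally Lipschitz and an upper gradient can be written down
from pointwise slopes (`isUpperGradient_of_local_slope_le`, `IsUpperGradient.tsum`). This is why no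
Poincaré inequality enters.

The supremum and the Lipschitz constant of f_k - f_{k-1} are at most M_k ‖f‖_{L¹}, where M_k
(`diffBound`) depends on the geometry only. The thicknesses ρ_k can therefore be chosen tiny
relative to M_k before f is known (`BoundaryEstimates.exists_isLayering`). This keeps E linear and
makes every contribution of M_k summable. What remains of the gradient is (2/ρ_k)|f_k - f_{k-1}| on
a layer of thickness comparable to ρ_k. By codimension 1 regularity and Fubini, an integral over
such a layer is about ρ_k times an integral over ∂Ω (`lintegral_layer_le`), so ρ_k cancels.
Comparing both smoothings with f bounds ∑ ∫ |f_k - f_{k-1}| by ‖f‖_{L¹} plus the mean oscillations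
of f at dyadic scales, which the integral in dt/t controls (`tsum_meanOscillation_le`).

For the trace, Ef is near ∂Ω a convex combination of the f_k (`IsLayering.exists_weights`). In a
ball of radius r about a Lebesgue point, scales s_k ≥ 2r give averages over balls comparable to
balls about that point. Scales s_k < 2r are bounded crudely, but they act only on layers whose
measure is a tiny part of the ball (`IsLayering.hasTraceAt`). The trace thus exists for every f in
L¹; the Besov condition serves only the BV bound. -/

/-- The variation of a continuous curve of bounded variation depends continuously on the
end point. -/
lemma continuousOn_variationOnFromTo {E : Type*} [PseudoMetricSpace E] {γ : ℝ → E} {s : Set ℝ}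
    {a : ℝ} (ha : a ∈ s) (hγ : ContinuousOn γ s) (hv : BoundedVariationOn γ s) :
    ContinuousOn (variationOnFromTo γ s a) s := by
  intro x hx
  have h1 := hv.tendsto_eVariationOn_Icc_zero_right x ((hγ x hx).mono inter_subset_left)
  have h2 := hv.tendsto_eVariationOn_Icc_zero_left ((hγ x hx).mono inter_subset_left)
  have h1' := (ENNReal.tendsto_toReal ENNReal.zero_ne_top).comp h1
  have h2' := (ENNReal.tendsto_toReal ENNReal.zero_ne_top).comp h2
  have h := h1'.add h2'
  simp only [ENNReal.toReal_zero, add_zero] at h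
  rw [ContinuousWithinAt, tendsto_iff_dist_tendsto_zero]
  refine squeeze_zero' (Eventually.of_forall fun _ => dist_nonneg) ?_ h
  filter_upwards [self_mem_nhdsWithin] with y hy
  have hadd := variationOnFromTo.add hv.locallyBoundedVariationOn ha hx hy
  have hd : variationOnFromTo γ s a y - variationOnFromTo γ s a x = variationOnFromTo γ s x y := by
    linarith
  rw [Real.dist_eq, hd]
  simp only [Function.comp_apply]
  rcases le_total x y with hxy | hxy
  · rw [variationOnFromTo.eq_of_le _ _ hxy, abs_of_nonneg ENNReal.toReal_nonneg]
    exact le_add_of_nonneg_right ENNReal.toReal_nonneg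
  · rw [variationOnFromTo.eq_of_ge _ _ hxy, abs_neg, abs_of_nonneg ENNReal.toReal_nonneg]
    exact le_add_of_nonneg_left ENNReal.toReal_nonneg

/-- Continuity of the arc length and the intermediate value theorem exclude gaps. Unit speed of the
natural parametrization is known only on this image, so a full interval is needed. -/
lemma image_variationOnFromTo_Icc {E : Type*} [PseudoMetricSpace E] {γ : ℝ → E} {a b : ℝ}
    (hab : a ≤ b) (hγ : ContinuousOn γ (Icc a b)) (hv : BoundedVariationOn γ (Icc a b)) :
    variationOnFromTo γ (Icc a b) a '' Icc a b =
      Icc 0 (eVariationOn γ (Icc a b)).toReal := by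
  have ha : a ∈ Icc a b := left_mem_Icc.2 hab
  have hb : b ∈ Icc a b := right_mem_Icc.2 hab
  have h0 : variationOnFromTo γ (Icc a b) a a = 0 := variationOnFromTo.self _ _ _
  have h1 : variationOnFromTo γ (Icc a b) a b = (eVariationOn γ (Icc a b)).toReal := by
    rw [variationOnFromTo.eq_of_le _ _ hab, inter_self]
  have hmono := variationOnFromTo.monotoneOn hv.locallyBoundedVariationOn ha
  apply Subset.antisymm
  · rintro _ ⟨t, ht, rfl⟩
    rw [← h1]
    exact ⟨variationOnFromTo.nonneg_of_le _ _ ht.1, hmono ht hb ht.2⟩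
  · have := intermediate_value_Icc hab (continuousOn_variationOnFromTo ha hγ hv)
    rwa [h0, h1] at this

/-! ### The arc-length parametrization as a 1-Lipschitz curve -/

section NaturalParameterization

variable {E : Type*} [MetricSpace E] {γ : ℝ → E} {a b : ℝ}

lemma naturalParameterization_zero (hab : a ≤ b) (hv : BoundedVariationOn γ (Icc a b)) :
    naturalParameterization γ (Icc a b) a 0 = γ a := by
  have ha : a ∈ Icc a b := left_mem_Icc.2 hab
  have := edist_naturalParameterization_eq_zero hv.locallyBoundedVariationOn ha ha
  rw [variationOnFromTo.self] at this
  exact edist_eq_zero.1 this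

lemma naturalParameterization_length (hab : a ≤ b) (hv : BoundedVariationOn γ (Icc a b)) :
    naturalParameterization γ (Icc a b) a (eVariationOn γ (Icc a b)).toReal = γ b := by
  have ha : a ∈ Icc a b := left_mem_Icc.2 hab
  have hb : b ∈ Icc a b := right_mem_Icc.2 hab
  have := edist_naturalParameterization_eq_zero hv.locallyBoundedVariationOn ha hb
  rw [variationOnFromTo.eq_of_le _ _ hab, inter_self] at this
  exact edist_eq_zero.1 this

/-- Unit speed says that the variation over a subinterval is its length, and the distance between
end points is at most the variation. -/
lemma lipschitzOnWith_naturalParameterization (hab : a ≤ b) (hγ : ContinuousOn γ (Icc a b))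
    (hv : BoundedVariationOn γ (Icc a b)) :
    LipschitzOnWith 1 (naturalParameterization γ (Icc a b) a)
      (Icc 0 (eVariationOn γ (Icc a b)).toReal) := by
  have ha : a ∈ Icc a b := left_mem_Icc.2 hab
  have h := has_unit_speed_naturalParameterization γ hv.locallyBoundedVariationOn ha
  rw [image_variationOnFromTo_Icc hab hγ hv] at h
  have key : ∀ x ∈ Icc 0 (eVariationOn γ (Icc a b)).toReal,
      ∀ y ∈ Icc 0 (eVariationOn γ (Icc a b)).toReal, x ≤ y →
      edist (naturalParameterization γ (Icc a b) a x)
        (naturalParameterization γ (Icc a b) a y) ≤ edist x y := by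
    intro x hx y hy hxy
    have h' := h hx hy
    refine (eVariationOn.edist_le _ (s := Icc 0 (eVariationOn γ (Icc a b)).toReal ∩ Icc x y)
      ⟨hx, left_mem_Icc.2 hxy⟩ ⟨hy, right_mem_Icc.2 hxy⟩).trans ?_
    rw [h', edist_comm, edist_dist, Real.dist_eq, abs_of_nonneg (sub_nonneg.2 hxy)]
    simp
  intro x hx y hy
  rw [ENNReal.coe_one, one_mul]
  rcases le_total x y with hxy | hxy
  · exact key x hx y hy hxy
  · rw [edist_comm, edist_comm x]
    exact key y hy x hx hxy

end NaturalParameterization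

/-- A function whose right slopes are controlled by a continuous function grows at most by its
integral. -/
lemma abs_sub_le_integral_of_slope_le {h φ : ℝ → ℝ} {ℓ : ℝ} (hℓ : 0 ≤ ℓ)
    (hh : ContinuousOn h (Icc 0 ℓ)) (hφ : Continuous φ)
    (hs : ∀ x ∈ Ico 0 ℓ, ∀ ε > 0, ∀ᶠ y in 𝓝[>] x, |h y - h x| ≤ (φ x + ε) * (y - x)) :
    |h ℓ - h 0| ≤ ∫ t in (0 : ℝ)..ℓ, φ t := by
  -- The comparison principle needs a strict inequality between derivatives, hence the slack ε,
  -- which is removed at the end.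
  have main : ∀ ε > 0, |h ℓ - h 0| ≤ (∫ t in (0 : ℝ)..ℓ, φ t) + ε * ℓ := by
    intro ε hε
    have hB : ∀ x, HasDerivAt (fun t => (∫ u in (0 : ℝ)..t, φ u) + ε * t) (φ x + ε) x := by
      intro x
      have h1 := intervalIntegral.integral_hasDerivAt_right (hφ.intervalIntegrable 0 x)
        (hφ.stronglyMeasurableAtFilter _ _) hφ.continuousAt
      simpa using! h1.add ((hasDerivAt_id x).const_mul ε)
    have := image_norm_le_of_liminf_right_slope_norm_lt_deriv_boundary
      (f := fun t => h t - h 0) (f' := φ) (a := 0) (b := ℓ)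
      (B := fun t => (∫ u in (0 : ℝ)..t, φ u) + ε * t) (B' := fun t => φ t + ε)
      (hh.sub continuousOn_const) ?_ (by simp) (fun x _ => (hB x).continuousAt.continuousWithinAt)
      (fun x _ => (hB x).hasDerivWithinAt) (fun x _ _ => by linarith)
      (right_mem_Icc.2 hℓ)
    · simpa using this
    · intro x hx r hr
      have hε' : 0 < (r - φ x) / 2 := by linarith
      apply Eventually.frequently
      filter_upwards [hs x hx _ hε', self_mem_nhdsWithin] with y hy hxy
      have hxy' : 0 < y - x := sub_pos.2 hxy
      rw [slope_def_field, div_lt_iff₀ hxy']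
      have h1 : ‖h y - h 0‖ - ‖h x - h 0‖ ≤ |h y - h x| := by
        have := abs_sub_abs_le_abs_sub (h y - h 0) (h x - h 0)
        simpa [Real.norm_eq_abs] using this
      simp only [Function.comp_apply]
      nlinarith
  refine le_of_forall_pos_le_add fun ε hε => ?_
  -- Dividing by ℓ + 1 rather than ℓ covers constant curves.
  have h1 := main (ε / (ℓ + 1)) (by positivity)
  have h2 : ε / (ℓ + 1) * ℓ ≤ ε := by
    rw [div_mul_eq_mul_div, div_le_iff₀ (by positivity)]
    nlinarith
  linarith

/-- A continuous bound on the local slopes of a function is an upper gradient. -/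
lemma isUpperGradient_of_local_slope_le {Y : Type*} [MetricSpace Y] [MeasurableSpace Y]
    [OpensMeasurableSpace Y] {u g : Y → ℝ} (hg : Continuous g) (hg0 : ∀ p, 0 ≤ g p)
    (h : ∀ p, ∀ ε > 0, ∀ᶠ q in 𝓝 p, |u q - u p| ≤ (g p + ε) * dist q p) :
    IsUpperGradient (fun p => ENNReal.ofReal (g p)) u := by
  refine ⟨hg.measurable.ennreal_ofReal, fun a b γ hab hγ hv => ?_⟩
  set ℓ := (eVariationOn γ (Icc a b)).toReal with hℓdef
  have hℓ : 0 ≤ ℓ := ENNReal.toReal_nonneg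
  set σ := naturalParameterization γ (Icc a b) a with hσ
  have hlip : LipschitzOnWith 1 σ (Icc 0 ℓ) := lipschitzOnWith_naturalParameterization hab hγ hv
  have hu : Continuous u := by
    rw [continuous_iff_continuousAt]
    intro p
    rw [ContinuousAt, tendsto_iff_dist_tendsto_zero]
    have h0 : Tendsto (fun q => (g p + 1) * dist q p) (𝓝 p) (𝓝 0) := by
      have : Continuous fun q => (g p + 1) * dist q p := by fun_prop
      simpa using this.tendsto p
    refine squeeze_zero' (Eventually.of_forall fun _ => dist_nonneg) ?_ h0
    filter_upwards [h p 1 one_pos] with q hq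
    rwa [Real.dist_eq]
  -- The comparison lemma wants a continuous function on the whole line, so g ∘ σ is continued by
  -- constants beyond [0, ℓ].
  have hφ : Continuous (IccExtend hℓ ((Icc 0 ℓ).domRestrict (g ∘ σ))) :=
    ((hg.comp_continuousOn hlip.continuousOn).domRestrict).Icc_extend'
  have key := abs_sub_le_integral_of_slope_le (h := u ∘ σ) hℓ
    (hu.comp_continuousOn hlip.continuousOn) hφ ?_
  · have hint : ∫ t in (0 : ℝ)..ℓ, IccExtend hℓ ((Icc 0 ℓ).domRestrict (g ∘ σ)) t
        = ∫ t in Icc 0 ℓ, g (σ t) := by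
      rw [intervalIntegral.integral_of_le hℓ, ← integral_Icc_eq_integral_Ioc]
      refine setIntegral_congr_fun measurableSet_Icc fun t ht => ?_
      rw [IccExtend_of_mem hℓ _ ht]; rfl
    have hi : IntegrableOn (fun t => g (σ t)) (Icc 0 ℓ) :=
      (hg.comp_continuousOn hlip.continuousOn).integrableOn_Icc
    rw [hint] at key
    have h0 : σ 0 = γ a := naturalParameterization_zero hab hv
    have h1 : σ ℓ = γ b := naturalParameterization_length hab hv
    simp only [Function.comp_apply, h0, h1] at key
    rw [lineIntegral, ← ofReal_integral_eq_lintegral_ofReal hi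
      (Eventually.of_forall fun t => hg0 _), Real.enorm_eq_ofReal_abs]
    exact ENNReal.ofReal_le_ofReal key
  · intro x hx ε hε
    have hx' : x ∈ Icc 0 ℓ := Ico_subset_Icc_self hx
    have hnhds : Icc 0 ℓ ∈ 𝓝[>] x :=
      mem_of_superset (Ioc_mem_nhdsGT hx.2) fun y hy => ⟨hx.1.trans hy.1.le, hy.2⟩
    have hcont : Tendsto σ (𝓝[>] x) (𝓝 (σ x)) := by
      have := hlip.continuousOn x hx'
      exact tendsto_nhdsWithin_congr (fun _ _ => rfl)
        (this.tendsto.mono_left (nhdsWithin_le_iff.2 hnhds))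
    filter_upwards [hcont.eventually (h (σ x) ε hε), hnhds, self_mem_nhdsWithin] with y hy hyI hxy
    rw [IccExtend_of_mem hℓ _ hx']
    refine hy.trans ?_
    -- Since σ is 1-Lipschitz, a slope bound for u at σ x becomes a slope bound for u ∘ σ at x.
    have hd : dist (σ y) (σ x) ≤ y - x := by
      have := hlip.dist_le_mul y hyI x hx'
      rwa [NNReal.coe_one, one_mul, Real.dist_eq, abs_of_pos (sub_pos.2 hxy)] at this
    exact mul_le_mul_of_nonneg_left hd (add_nonneg (hg0 _) hε.le)

/-- Upper gradients of the terms of a series that is finite along compact sets add up to an upper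
gradient of the sum. -/
lemma IsUpperGradient.tsum {Y : Type*} [MetricSpace Y] [MeasurableSpace Y]
    {u : ℕ → Y → ℝ} {g : ℕ → Y → ℝ≥0∞} {U : Y → ℝ} (h : ∀ k, IsUpperGradient (g k) (u k))
    (hU : ∀ p q, ∃ K, U p = ∑ k ∈ Finset.range K, u k p ∧ U q = ∑ k ∈ Finset.range K, u k q) :
    IsUpperGradient (fun p => ∑' k, g k p) U := by
  refine ⟨Measurable.tsum fun k => (h k).1, fun a b γ hab hγ hv => ?_⟩
  obtain ⟨K, hb, ha⟩ := hU (γ b) (γ a)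
  -- Superadditivity of the lower integral is enough here, and it needs no measurability along the
  -- curve.
  have hsuper : ∀ s : Finset ℕ, ∑ k ∈ s, lineIntegral (g k) γ a b ≤
      lineIntegral (fun p => ∑ k ∈ s, g k p) γ a b := by
    intro s
    induction s using Finset.induction_on with
    | empty => simp
    | insert i s hi ih =>
      rw [Finset.sum_insert hi]
      refine (add_le_add le_rfl ih).trans ?_
      refine (le_lintegral_add _ _).trans (lintegral_mono fun t => ?_)
      simp only [Finset.sum_insert hi]
      exact le_rfl
  calc ‖U (γ b) - U (γ a)‖ₑ
      = ‖∑ k ∈ Finset.range K, (u k (γ b) - u k (γ a))‖ₑ := by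
        rw [hb, ha, Finset.sum_sub_distrib]
    _ ≤ ∑ k ∈ Finset.range K, ‖u k (γ b) - u k (γ a)‖ₑ := enorm_sum_le _ _
    _ ≤ ∑ k ∈ Finset.range K, lineIntegral (g k) γ a b :=
        Finset.sum_le_sum fun k _ => (h k).2 a b γ hab hγ hv
    _ ≤ lineIntegral (fun p => ∑ k ∈ Finset.range K, g k p) γ a b := hsuper _
    _ ≤ lineIntegral (fun p => ∑' k, g k p) γ a b :=
        lintegral_mono fun t => ENNReal.sum_le_tsum _

/-! ### Consequences of the doubling condition -/

section Doubling

variable {X : Type*} [MetricSpace X] [MeasurableSpace X] {μ : Measure X}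

lemma IsDoubling.measure_ball_pos (hμ : IsDoubling μ) (z : X) {r : ℝ} (hr : 0 < r) :
    0 < μ (Metric.ball z r) := by
  obtain ⟨C, hC⟩ := hμ
  simpa [mul_div_cancel₀] using (hC z (r / 2) (by positivity)).1

lemma IsDoubling.measure_ball_lt_top (hμ : IsDoubling μ) (z : X) (r : ℝ) :
    μ (Metric.ball z r) < ∞ := by
  rcases le_or_gt r 0 with hr | hr
  · simp [Metric.ball_eq_empty.2 hr]
  obtain ⟨C, hC⟩ := hμ
  obtain ⟨-, h2, h3⟩ := hC z (r / 2) (by positivity)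
  rw [mul_div_cancel₀ r (two_ne_zero)] at h2
  exact h2.trans_lt h3

lemma measure_ball_two_pow_mul_le {C : ℝ≥0} (hC : ∀ (z : X) (r : ℝ), 0 < r →
    μ (Metric.ball z (2 * r)) ≤ C * μ (Metric.ball z r)) (z : X) {r : ℝ} (hr : 0 < r) (n : ℕ) :
    μ (Metric.ball z (2 ^ n * r)) ≤ (C : ℝ≥0∞) ^ n * μ (Metric.ball z r) := by
  induction n with
  | zero => simp
  | succ n ih =>
    calc μ (Metric.ball z (2 ^ (n + 1) * r)) = μ (Metric.ball z (2 * (2 ^ n * r))) := by ring_nf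
      _ ≤ C * μ (Metric.ball z (2 ^ n * r)) := hC z _ (by positivity)
      _ ≤ C * (C ^ n * μ (Metric.ball z r)) := by gcongr
      _ = C ^ (n + 1) * μ (Metric.ball z r) := by ring

lemma IsDoubling.exists_const (hμ : IsDoubling μ) : ∃ C : ℝ≥0, 1 ≤ C ∧
    ∀ (z : X) (r : ℝ), 0 < r → μ (Metric.ball z (2 * r)) ≤ C * μ (Metric.ball z r) := by
  obtain ⟨C, hC⟩ := hμ
  refine ⟨max C 1, le_max_right _ _, fun z r hr => (hC z r hr).2.1.trans ?_⟩
  gcongr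
  exact le_max_left _ _

/-- Bounded sets in a space with a doubling measure are totally bounded. -/
lemma IsDoubling.exists_finite_cover [OpensMeasurableSpace X] (hμ : IsDoubling μ) {s : Set X}
    (hs : Bornology.IsBounded s) {ε : ℝ} (hε : 0 < ε) :
    ∃ N : Set X, N ⊆ s ∧ N.Finite ∧ s ⊆ ⋃ x ∈ N, Metric.ball x ε := by
  rcases s.eq_empty_or_nonempty with rfl | ⟨x₀, hx₀⟩
  · exact ⟨∅, by simp⟩
  obtain ⟨ρ, hρ0, hρ⟩ : ∃ ρ : ℝ, 0 < ρ ∧ s ⊆ Metric.ball x₀ ρ := by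
    obtain ⟨ρ, hρ⟩ := hs.subset_ball x₀
    exact ⟨max ρ 1, by positivity, hρ.trans (Metric.ball_subset_ball (le_max_left _ _))⟩
  obtain ⟨C, hC1, hC⟩ := hμ.exists_const
  -- The centres of a Vitali family of disjoint balls of radius ε/6 form the net: enlarging by 5
  -- leaves every point within 5ε/6 < ε of a centre.
  obtain ⟨u, hus, hdisj, hcov⟩ := Vitali.exists_disjoint_subfamily_covering_enlargement_closedBall
    s id (fun _ => ε / 6) (ε / 6) (fun _ _ => le_rfl) 5 (by norm_num)
  -- After n doublings each small ball contains the ball of radius ρ about x₀. This bounds all their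
  -- measures from below, so only finitely many fit disjointly into a set of finite measure.
  obtain ⟨n, hn⟩ : ∃ n : ℕ, 2 * ρ ≤ 2 ^ n * (ε / 6) := by
    obtain ⟨n, hn⟩ := pow_unbounded_of_one_lt (2 * ρ / (ε / 6)) (one_lt_two)
    exact ⟨n, by rw [div_lt_iff₀ (by positivity)] at hn; exact hn.le⟩
  have hfin : u.Finite := by
    have hc : 0 < ((C : ℝ≥0∞) ^ n)⁻¹ * μ (Metric.ball x₀ ρ) :=
      ENNReal.mul_pos (ENNReal.inv_ne_zero.2 (ENNReal.pow_ne_top ENNReal.coe_ne_top))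
        (hμ.measure_ball_pos x₀ hρ0).ne'
    have := Measure.finite_const_le_meas_of_disjoint_iUnion μ hc
      (As := fun a : u => Metric.closedBall (a : X) (ε / 6))
      (fun a => Metric.isClosed_closedBall.measurableSet)
      (fun a b hab => hdisj a.2 b.2 (fun h => hab (Subtype.ext h))) ?_
    · have huniv : {a : u | ((C : ℝ≥0∞) ^ n)⁻¹ * μ (Metric.ball x₀ ρ) ≤
          μ (Metric.closedBall (a : X) (ε / 6))} = univ := by
        refine eq_univ_of_forall fun a => ?_
        have hC0 : (C : ℝ≥0∞) ^ n ≠ 0 :=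
          pow_ne_zero _ (by exact_mod_cast (zero_lt_one.trans_le hC1).ne')
        rw [mem_ofPred_eq, ENNReal.inv_mul_le_iff hC0 (ENNReal.pow_ne_top ENNReal.coe_ne_top)]
        refine (measure_mono ?_).trans
          ((measure_ball_two_pow_mul_le hC (a : X) (r := ε / 6) (by positivity) n).trans ?_)
        · refine Metric.ball_subset_ball' ?_
          have := hρ (hus a.2)
          rw [Metric.mem_ball, dist_comm] at this
          linarith
        · gcongr
          exact Metric.ball_subset_closedBall
      rw [huniv] at this
      exact Set.finite_coe_iff.1 (Set.finite_univ_iff.1 this)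
    · refine ((measure_mono ?_).trans_lt (hμ.measure_ball_lt_top x₀ (ρ + ε))).ne
      refine iUnion_subset fun a => (Metric.closedBall_subset_ball' (ε₂ := ρ + ε) ?_)
      have := hρ (hus a.2)
      rw [Metric.mem_ball] at this
      linarith
  refine ⟨u, hus, hfin, fun x hx => ?_⟩
  obtain ⟨b, hb, hxb⟩ := hcov x hx
  have := hxb (Metric.mem_closedBall_self (by positivity))
  refine mem_iUnion₂.2 ⟨b, hb, ?_⟩
  rw [Metric.mem_closedBall] at this
  rw [Metric.mem_ball]
  simp only [id] at this
  linarith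

lemma IsDoubling.secondCountableTopology [OpensMeasurableSpace X] (hμ : IsDoubling μ) :
    SecondCountableTopology X := by
  rcases isEmpty_or_nonempty X with hX | ⟨⟨x₀⟩⟩
  · infer_instance
  refine Metric.secondCountable_of_almost_dense_set fun ε hε => ?_
  choose N hN using fun n : ℕ =>
    hμ.exists_finite_cover (Metric.isBounded_ball (x := x₀) (r := (n : ℝ))) hε
  refine ⟨⋃ n, N n, countable_iUnion fun n => (hN n).2.1.countable, fun x => ?_⟩
  obtain ⟨n, hn⟩ := exists_nat_gt (dist x x₀)
  obtain ⟨y, hy, hxy⟩ := mem_iUnion₂.1 ((hN n).2.2 (Metric.mem_ball.2 hn))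
  exact ⟨y, mem_iUnion.2 ⟨n, hy⟩, (Metric.mem_ball.1 hxy).le⟩

end Doubling

/-! ### The measures on the domain and on its boundary -/

lemma domainMeasure_apply {X : Type*} [MeasurableSpace X] {μ : Measure X} {Ω : Set X}
    (hΩ : MeasurableSet Ω) (s : Set Ω) :
    domainMeasure μ Ω s = μ (Subtype.val '' s) :=
  (MeasurableEmbedding.subtype_coe hΩ).comap_apply _ _

/-- An open set misses its frontier, so the closure contains two distinct points. This makes the
range of radii in the regularity condition nonempty. -/
lemma diam_pos_of_mem_frontier {X : Type*} [MetricSpace X] {Ω : Set X} (hΩ : IsOpen Ω)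
    (hb : Bornology.IsBounded Ω) {z : X} (hz : z ∈ frontier Ω) : 0 < Metric.diam Ω := by
  obtain ⟨p, hp, -⟩ := Metric.mem_closure_iff.1 (frontier_subset_closure hz) 1 one_pos
  have hne : z ≠ p := by
    rintro rfl
    rw [hΩ.frontier_eq] at hz
    exact hz.2 hp
  rw [← Metric.diam_closure]
  exact (dist_pos.2 hne).trans_le (Metric.dist_le_diam_of_mem hb.closure
    (frontier_subset_closure hz) (subset_closure hp))

section BoundaryMeasure

variable {X : Type*} [MetricSpace X] [MeasurableSpace X] [BorelSpace X] {μ : Measure X}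
  {Ω : Set X}

lemma boundaryMeasure_apply (s : Set (frontier Ω)) :
    boundaryMeasure μ Ω s = codimOneHausdorff μ (Subtype.val '' s) :=
  (MeasurableEmbedding.subtype_coe isClosed_frontier.measurableSet).comap_apply _ _

lemma boundaryMeasure_ball (x : frontier Ω) (r : ℝ) :
    boundaryMeasure μ Ω (Metric.ball x r) =
      codimOneHausdorff μ (Metric.ball (x : X) r ∩ frontier Ω) := by
  rw [boundaryMeasure_apply]
  congr 1
  ext y
  constructor
  · rintro ⟨z, hz, rfl⟩
    exact ⟨hz, z.2⟩
  · rintro ⟨hy, hyΩ⟩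
    exact ⟨⟨y, hyΩ⟩, hy, rfl⟩

omit [MetricSpace X] [BorelSpace X] in
lemma domainMeasure_preimage_le (hΩ : MeasurableSet Ω) (s : Set X) :
    domainMeasure μ Ω (Subtype.val ⁻¹' s) ≤ μ s := by
  rw [domainMeasure_apply hΩ]
  exact measure_mono (image_preimage_subset _ _)

omit [BorelSpace X] in
lemma isFiniteMeasure_domainMeasure (hμ : IsDoubling μ) (hΩ : MeasurableSet Ω)
    (hb : Bornology.IsBounded Ω) : IsFiniteMeasure (domainMeasure μ Ω) := by
  refine ⟨?_⟩
  rw [domainMeasure_apply hΩ, image_univ, Subtype.range_coe]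
  rcases Ω.eq_empty_or_nonempty with h | ⟨x, -⟩
  · simp [h]
  · obtain ⟨r, hr⟩ := hb.subset_ball x
    exact (measure_mono hr).trans_lt (hμ.measure_ball_lt_top x r)

lemma domainMeasure_ball_pos (hμ : IsDoubling μ) (hΩ : IsOpen Ω) {z : X} (hz : z ∈ frontier Ω)
    {r : ℝ} (hr : 0 < r) : 0 < domainMeasure μ Ω (Subtype.val ⁻¹' Metric.ball z r) := by
  obtain ⟨p, hp, hpz⟩ := Metric.mem_closure_iff.1 (frontier_subset_closure hz) r hr
  have hopen : IsOpen (Ω ∩ Metric.ball z r) := hΩ.inter Metric.isOpen_ball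
  obtain ⟨ε, hε, hsub⟩ := Metric.isOpen_iff.1 hopen p ⟨hp, by rwa [Metric.mem_ball, dist_comm]⟩
  rw [domainMeasure_apply hΩ.measurableSet, Subtype.image_preimage_coe]
  exact (hμ.measure_ball_pos p hε).trans_le (measure_mono hsub)

/-- The estimates for the boundary measure and for boundary layers on which the extension is
based; they hold up to the scale `D`. -/
structure BoundaryEstimates (μ : Measure X) (Ω : Set X) (A : ℝ≥0) (D : ℝ) : Prop where
  pos : 0 < D
  one_le : 1 ≤ A
  nonempty : (frontier Ω).Nonempty
  isFinite_boundary : IsFiniteMeasure (boundaryMeasure μ Ω)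
  isFinite_domain : IsFiniteMeasure (domainMeasure μ Ω)
  secondCountable : SecondCountableTopology X
  exists_finite_cover : ∀ ε > 0, ∃ N : Set X, N ⊆ frontier Ω ∧ N.Finite ∧
    frontier Ω ⊆ ⋃ x ∈ N, Metric.ball x ε
  ball_pos : ∀ (x : frontier Ω) (r : ℝ), 0 < r → 0 < boundaryMeasure μ Ω (Metric.ball x r)
  domain_ball_pos : ∀ (x : frontier Ω) (r : ℝ), 0 < r →
    0 < domainMeasure μ Ω (Subtype.val ⁻¹' Metric.ball (x : X) r)
  doubling : ∀ (x : frontier Ω) (r : ℝ), 0 < r → r ≤ D →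
    boundaryMeasure μ Ω (Metric.ball x (2 * r)) ≤ A * boundaryMeasure μ Ω (Metric.ball x r)
  layer : ∀ ρ : ℝ, 0 < ρ → ρ ≤ D → ∀ (G : X → ℝ≥0∞) (c : ℝ≥0∞), Measurable G →
    (∀ (p : Ω) (z : frontier Ω), dist (p : X) z < 2 * ρ → G p ≤ G z + c) →
    ∫⁻ p in {p : Ω | Metric.infDist (p : X) (frontier Ω) < ρ}, G p ∂(domainMeasure μ Ω) ≤
      A * ENNReal.ofReal ρ * ∫⁻ z, (G z + c) ∂(boundaryMeasure μ Ω)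

/-- Fubini: G p is at most the average of G + c over the boundary points within 2ρ of p, and
exchanging the integrals leaves for each z the weight ∫ q(p)⁻¹ over points within 2ρ of z.
Regularity bounds q(p) below by a multiple of μ(B(z, 2ρ))/ρ, so this weight is at most Aρ. -/
lemma lintegral_layer_le (hμ : IsDoubling μ) (hΩ : MeasurableSet Ω)
    (hne : (frontier Ω).Nonempty) [SecondCountableTopology X]
    [IsFiniteMeasure (boundaryMeasure μ Ω)] [IsFiniteMeasure (domainMeasure μ Ω)]
    {A : ℝ≥0} (hA : A ≠ 0) {ρ : ℝ} (hρ : 0 < ρ)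
    (hball : ∀ x : frontier Ω, μ (Metric.ball (x : X) (8 * ρ)) / ENNReal.ofReal ρ ≤
      A * boundaryMeasure μ Ω (Metric.ball x ρ))
    {G : X → ℝ≥0∞} {c : ℝ≥0∞} (hG : Measurable G)
    (hGc : ∀ (p : Ω) (z : frontier Ω), dist (p : X) z < 2 * ρ → G p ≤ G z + c) :
    ∫⁻ p in {p : Ω | Metric.infDist (p : X) (frontier Ω) < ρ}, G p ∂(domainMeasure μ Ω) ≤
      A * ENNReal.ofReal ρ * ∫⁻ z, (G z + c) ∂(boundaryMeasure μ Ω) := by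
  set ν := boundaryMeasure μ Ω with hν
  set m := domainMeasure μ Ω with hm
  set T : Set (Ω × frontier Ω) := {w | dist (w.1 : X) w.2 < 2 * ρ} with hT
  have hTm : MeasurableSet T := by
    refine (isOpen_lt ?_ continuous_const).measurableSet
    fun_prop
  set q : Ω → ℝ≥0∞ := fun p => ν (Prod.mk p ⁻¹' T) with hq
  have hqm : Measurable q := measurable_measure_prodMk_left hTm
  set L : Set Ω := {p : Ω | Metric.infDist (p : X) (frontier Ω) < ρ} with hL
  have hLm : MeasurableSet L := by
    refine (isOpen_lt ?_ continuous_const).measurableSet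
    exact (Metric.continuous_infDist_pt _).comp continuous_subtype_val
  have hρ' : ENNReal.ofReal ρ ≠ 0 := by simpa using hρ
  have hA0 : (A : ℝ≥0∞) ≠ 0 := by exact_mod_cast hA
  -- A boundary point x within ρ of p satisfies B(x, ρ) ⊆ B(p, 2ρ) and B(z, 2ρ) ⊆ B(x, 5ρ). The
  -- radius 8ρ in `hball` is the next power of two.
  have hqlow : ∀ p ∈ L, ∀ z : frontier Ω, dist (p : X) z < 2 * ρ →
      μ (Metric.ball (z : X) (2 * ρ)) / ENNReal.ofReal ρ ≤ A * q p := by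
    intro p hp z hz
    obtain ⟨x, hx, hpx⟩ := (Metric.infDist_lt_iff hne).1 hp
    refine (ENNReal.div_le_div_right (measure_mono ?_) _).trans ((hball ⟨x, hx⟩).trans ?_)
    · refine Metric.ball_subset_ball' ?_
      have := dist_triangle_left (z : X) x p
      simp only
      linarith
    · refine mul_le_mul_right (measure_mono fun y hy => ?_) _
      have h1 : dist (y : X) x < ρ := hy
      have := dist_triangle_right (p : X) y x
      change dist (p : X) y < 2 * ρ
      linarith
  have hq0 : ∀ p ∈ L, q p ≠ 0 := by
    intro p hp h0
    obtain ⟨x, hx, hpx⟩ := (Metric.infDist_lt_iff hne).1 hp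
    have := hqlow p hp ⟨x, hx⟩ (by simp only; linarith)
    rw [h0, mul_zero, nonpos_iff_eq_zero, ENNReal.div_eq_zero_iff] at this
    rcases this with h | h
    · exact (hμ.measure_ball_pos x (by positivity)).ne' h
    · exact ENNReal.ofReal_ne_top h
  have hqinv : ∀ p ∈ L, ∀ z : frontier Ω, dist (p : X) z < 2 * ρ →
      (q p)⁻¹ ≤ A * ENNReal.ofReal ρ * (μ (Metric.ball (z : X) (2 * ρ)))⁻¹ := by
    intro p hp z hz
    have h1 := ENNReal.inv_le_inv.2 (hqlow p hp z hz)
    rw [ENNReal.mul_inv (Or.inl hA0) (Or.inl ENNReal.coe_ne_top),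
      ENNReal.inv_div (Or.inl ENNReal.ofReal_ne_top) (Or.inl hρ')] at h1
    calc (q p)⁻¹ = A * ((A : ℝ≥0∞)⁻¹ * (q p)⁻¹) := by
          rw [← mul_assoc, ENNReal.mul_inv_cancel hA0 ENNReal.coe_ne_top, one_mul]
      _ ≤ A * (ENNReal.ofReal ρ / μ (Metric.ball (z : X) (2 * ρ))) := by gcongr
      _ = _ := by rw [div_eq_mul_inv, mul_assoc]
  -- The averaging kernel, normalized at p, multiplied by the boundary values.
  set F : Ω → frontier Ω → ℝ≥0∞ :=
    fun p z => T.indicator (fun w => (q w.1)⁻¹ * (G w.2 + c)) (p, z) with hF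
  have hFm : Measurable (Function.uncurry F) := by
    refine Measurable.indicator ?_ hTm
    exact ((hqm.comp measurable_fst).inv).mul
      ((hG.comp (measurable_subtype_coe.comp measurable_snd)).add_const c)
  have step1 : ∀ p ∈ L, G p ≤ ∫⁻ z, F p z ∂ν := by
    intro p hp
    have hTp : MeasurableSet (Prod.mk p ⁻¹' T) := measurable_prodMk_left hTm
    calc G p = (q p)⁻¹ * (G p * q p) := by
          rw [mul_comm (G p), ← mul_assoc, ENNReal.inv_mul_cancel (hq0 p hp)
            (measure_ne_top _ _), one_mul]
      _ = (q p)⁻¹ * ∫⁻ z in Prod.mk p ⁻¹' T, G p ∂ν := by rw [setLIntegral_const]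
      _ = ∫⁻ z in Prod.mk p ⁻¹' T, (q p)⁻¹ * G p ∂ν := by
          rw [lintegral_const_mul _ measurable_const]
      _ ≤ ∫⁻ z in Prod.mk p ⁻¹' T, (q p)⁻¹ * (G z + c) ∂ν := by
          refine setLIntegral_mono' hTp fun z hz => ?_
          gcongr
          exact hGc p z hz
      _ = ∫⁻ z, F p z ∂ν := by
          rw [← lintegral_indicator hTp]
          rfl
  have step2 : ∀ z : frontier Ω, ∫⁻ p in L, F p z ∂m ≤ A * ENNReal.ofReal ρ * (G z + c) := by
    intro z
    set b := μ (Metric.ball (z : X) (2 * ρ)) with hb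
    have hb0 : b ≠ 0 := (hμ.measure_ball_pos _ (by positivity)).ne'
    have hbt : b ≠ ∞ := (hμ.measure_ball_lt_top _ _).ne
    have hBm : MeasurableSet (Subtype.val ⁻¹' Metric.ball (z : X) (2 * ρ) : Set Ω) :=
      measurable_subtype_coe Metric.isOpen_ball.measurableSet
    calc ∫⁻ p in L, F p z ∂m
        ≤ ∫⁻ p in L, (Subtype.val ⁻¹' Metric.ball (z : X) (2 * ρ) : Set Ω).indicator
            (fun _ => A * ENNReal.ofReal ρ * b⁻¹ * (G z + c)) p ∂m := by
          refine setLIntegral_mono' hLm fun p hp => ?_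
          by_cases hpz : dist (p : X) z < 2 * ρ
          · simp only [hF]
            rw [indicator_of_mem (show (p, z) ∈ T from hpz),
              indicator_of_mem (show p ∈ (Subtype.val ⁻¹' Metric.ball (z : X) (2 * ρ) : Set Ω)
                from hpz)]
            gcongr
            exact hqinv p hp z hpz
          · simp only [hF]
            rw [indicator_of_notMem (show (p, z) ∉ T from hpz)]
            exact zero_le
      _ ≤ ∫⁻ p, (Subtype.val ⁻¹' Metric.ball (z : X) (2 * ρ) : Set Ω).indicator
            (fun _ => A * ENNReal.ofReal ρ * b⁻¹ * (G z + c)) p ∂m :=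
          setLIntegral_le_lintegral _ _
      _ = A * ENNReal.ofReal ρ * b⁻¹ * (G z + c) *
            m (Subtype.val ⁻¹' Metric.ball (z : X) (2 * ρ)) := by
          rw [lintegral_indicator_const hBm]
      _ ≤ A * ENNReal.ofReal ρ * b⁻¹ * (G z + c) * b := by
          gcongr
          exact domainMeasure_preimage_le hΩ _
      _ = A * ENNReal.ofReal ρ * (G z + c) * (b⁻¹ * b) := by ring
      _ = A * ENNReal.ofReal ρ * (G z + c) := by rw [ENNReal.inv_mul_cancel hb0 hbt, mul_one]
  calc ∫⁻ p in L, G p ∂m ≤ ∫⁻ p in L, ∫⁻ z, F p z ∂ν ∂m := setLIntegral_mono' hLm step1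
    _ = ∫⁻ z, ∫⁻ p in L, F p z ∂m ∂ν := lintegral_lintegral_swap hFm.aemeasurable
    _ ≤ ∫⁻ z, A * ENNReal.ofReal ρ * (G z + c) ∂ν := lintegral_mono step2
    _ = A * ENNReal.ofReal ρ * ∫⁻ z, (G z + c) ∂ν :=
        lintegral_const_mul _ ((hG.comp measurable_subtype_coe).add_const c)

lemma exists_boundaryEstimates (hμ : IsDoubling μ) (hΩ : IsOpen Ω) (hb : Bornology.IsBounded Ω)
    (hreg : IsCodimOneAhlforsRegular μ Ω) (hne : (frontier Ω).Nonempty) :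
    ∃ A D, BoundaryEstimates μ Ω A D := by
  obtain ⟨Cd, hCd1, hCd⟩ := hμ.exists_const
  obtain ⟨C, hC1, hC⟩ := hreg
  obtain ⟨z₀, hz₀⟩ := hne
  have hdiam := diam_pos_of_mem_frontier hΩ hb hz₀
  have hCd0 : Cd ≠ 0 := (zero_lt_one.trans_le hCd1).ne'
  have hC0 : C ≠ 0 := (zero_lt_one.trans_le hC1).ne'
  have hC0' : (C : ℝ≥0∞) ≠ 0 := by exact_mod_cast hC0
  have hlow : ∀ (x : frontier Ω) (r : ℝ), 0 < r → r ≤ Metric.diam Ω →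
      μ (Metric.ball (x : X) r) / ENNReal.ofReal r ≤
        C * boundaryMeasure μ Ω (Metric.ball x r) := by
    intro x r hr hrD
    rw [boundaryMeasure_ball]
    exact (ENNReal.inv_mul_le_iff hC0' ENNReal.coe_ne_top).1 (hC x x.2 r hr hrD).1
  have hup : ∀ (x : frontier Ω) (r : ℝ), 0 < r → r ≤ Metric.diam Ω →
      boundaryMeasure μ Ω (Metric.ball x r) ≤
        C * (μ (Metric.ball (x : X) r) / ENNReal.ofReal r) := by
    intro x r hr hrD
    rw [boundaryMeasure_ball]
    exact (hC x x.2 r hr hrD).2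
  have hfront : Bornology.IsBounded (frontier Ω) := hb.closure.subset frontier_subset_closure
  have hcov := fun (ε : ℝ) (hε : ε > 0) => hμ.exists_finite_cover hfront hε
  have hsc := hμ.secondCountableTopology
  have hfd := isFiniteMeasure_domainMeasure hμ hΩ.measurableSet hb
  have hfb : IsFiniteMeasure (boundaryMeasure μ Ω) := by
    refine ⟨?_⟩
    obtain ⟨N, hNs, hN, hcovN⟩ := hcov _ hdiam
    have hsub : (univ : Set (frontier Ω)) ⊆
        ⋃ x : N, Metric.ball ⟨x, hNs x.2⟩ (Metric.diam Ω) := by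
      intro y _
      obtain ⟨x, hx, hyx⟩ := mem_iUnion₂.1 (hcovN y.2)
      exact mem_iUnion.2 ⟨⟨x, hx⟩, hyx⟩
    have : Fintype N := hN.fintype
    refine (measure_mono hsub).trans_lt ((measure_iUnion_le _).trans_lt ?_)
    rw [tsum_fintype, ENNReal.sum_lt_top]
    intro x _
    refine (hup _ _ hdiam le_rfl).trans_lt ?_
    exact ENNReal.mul_lt_top ENNReal.coe_lt_top
      (ENNReal.div_lt_top (hμ.measure_ball_lt_top _ _).ne (by simpa using hdiam))
  -- The doubling estimate costs C² Cd and the layer estimate C Cd³; C² Cd³ dominates both.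
  have hCC : (C : ℝ≥0∞) * (C * Cd) ≤ ((C ^ 2 * Cd ^ 3 : ℝ≥0) : ℝ≥0∞) := by
    rw [← ENNReal.coe_mul, ← ENNReal.coe_mul, ENNReal.coe_le_coe]
    have h1 : Cd ≤ Cd ^ 3 := le_self_pow₀ hCd1 (by norm_num)
    calc C * (C * Cd) = C ^ 2 * Cd := by ring
      _ ≤ _ := by gcongr
  -- Half the diameter, because doubling at radius r uses regularity at radius 2r.
  refine ⟨C ^ 2 * Cd ^ 3, Metric.diam Ω / 2, by positivity, ?_, ⟨z₀, hz₀⟩, hfb,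
    hfd, hsc, hcov, ?_, fun x r hr => domainMeasure_ball_pos hμ hΩ x.2 hr, ?_, ?_⟩
  · exact one_le_mul (one_le_pow₀ hC1) (one_le_pow₀ hCd1)
  · intro x r hr
    -- Positivity is claimed for all radii, regularity only up to the diameter.
    have hs : 0 < min r (Metric.diam Ω) := lt_min hr hdiam
    refine lt_of_lt_of_le ?_ (measure_mono (Metric.ball_subset_ball (min_le_left r (Metric.diam Ω))))
    have h1 := hlow x _ hs (min_le_right _ _)
    rw [pos_iff_ne_zero]
    intro h0
    rw [h0, mul_zero, nonpos_iff_eq_zero, ENNReal.div_eq_zero_iff] at h1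
    rcases h1 with h | h
    · exact (hμ.measure_ball_pos _ hs).ne' h
    · exact ENNReal.ofReal_ne_top h
  · intro x r hr hrD
    calc boundaryMeasure μ Ω (Metric.ball x (2 * r))
        ≤ C * (μ (Metric.ball (x : X) (2 * r)) / ENNReal.ofReal (2 * r)) :=
          hup x _ (by positivity) (by linarith)
      _ ≤ C * (Cd * μ (Metric.ball (x : X) r) / ENNReal.ofReal r) := by
          gcongr
          · exact hCd _ _ hr
          · linarith
      _ = C * (Cd * (μ (Metric.ball (x : X) r) / ENNReal.ofReal r)) := by rw [mul_div_assoc]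
      _ ≤ C * (Cd * (C * boundaryMeasure μ Ω (Metric.ball x r))) := by
          gcongr
          exact hlow x r hr (by linarith)
      _ = C * (C * Cd) * boundaryMeasure μ Ω (Metric.ball x r) := by ring
      _ ≤ _ := by gcongr
  · intro ρ hρ hρD G c hG hGc
    refine lintegral_layer_le hμ hΩ.measurableSet ⟨z₀, hz₀⟩ (by positivity) hρ ?_ hG hGc
    intro x
    calc μ (Metric.ball (x : X) (8 * ρ)) / ENNReal.ofReal ρ
        ≤ Cd ^ 3 * μ (Metric.ball (x : X) ρ) / ENNReal.ofReal ρ := by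
          gcongr
          have := measure_ball_two_pow_mul_le hCd (x : X) hρ 3
          norm_num at this ⊢
          exact this
      _ = Cd ^ 3 * (μ (Metric.ball (x : X) ρ) / ENNReal.ofReal ρ) := by rw [mul_div_assoc]
      _ ≤ Cd ^ 3 * (C * boundaryMeasure μ Ω (Metric.ball x ρ)) := by
          gcongr
          exact hlow x ρ hρ (by linarith)
      _ = (Cd ^ 3 * C) * boundaryMeasure μ Ω (Metric.ball x ρ) := by ring
      _ ≤ _ := by
          gcongr
          rw [← ENNReal.coe_pow, ← ENNReal.coe_mul, ENNReal.coe_le_coe, mul_comm]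
          gcongr
          exact le_self_pow₀ hC1 (by norm_num)

end BoundaryMeasure

/-! ### Smoothing at a fixed scale -/

/-- The piecewise affine cutoff which is `1` on `(-∞, 1]` and `0` on `[2, ∞)`. -/
noncomputable def cutoff (t : ℝ) : ℝ := max 0 (min 1 (2 - t))

lemma cutoff_nonneg (t : ℝ) : 0 ≤ cutoff t := le_max_left _ _

lemma cutoff_le_one (t : ℝ) : cutoff t ≤ 1 := max_le zero_le_one (min_le_left _ _)

lemma cutoff_eq_one {t : ℝ} (h : t ≤ 1) : cutoff t = 1 := by
  rw [cutoff, min_eq_left (by linarith), max_eq_right zero_le_one]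

lemma cutoff_eq_zero {t : ℝ} (h : 2 ≤ t) : cutoff t = 0 := by
  rw [cutoff, max_eq_left]
  exact (min_le_right _ _).trans (by linarith)

lemma cutoff_antitone : Antitone cutoff := fun _ _ h =>
  max_le_max le_rfl (min_le_min le_rfl (by linarith))

lemma continuous_cutoff : Continuous cutoff := by
  unfold cutoff
  fun_prop

lemma abs_cutoff_sub_le (a b : ℝ) : |cutoff a - cutoff b| ≤ |a - b| := by
  unfold cutoff
  refine (abs_max_sub_max_le_max _ _ _ _).trans ?_
  rw [sub_self, abs_zero]
  refine max_le (abs_nonneg _) ((abs_min_sub_min_le_max _ _ _ _).trans ?_)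
  rw [sub_self, abs_zero]
  refine max_le (abs_nonneg _) ?_
  rw [abs_sub_comm]
  exact le_of_eq (by congr 1; ring)

section Smoothing

variable {X : Type*} [MetricSpace X] [MeasurableSpace X] {S : Set X}

/-- The total mass of the kernel `cutoff (dist p · / s)`. -/
noncomputable def kernelMass (ν : Measure S) (s : ℝ) (p : X) : ℝ :=
  ∫ y, cutoff (dist p y / s) ∂ν

/-- The average of `f` with respect to the kernel `cutoff (dist p · / s)`; the mass of the kernel
is truncated from below at the level `c`. -/
noncomputable def smoothing (ν : Measure S) (s c : ℝ) (f : S → ℝ) (p : X) : ℝ :=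
  (∫ y, cutoff (dist p y / s) * f y ∂ν) / max c (kernelMass ν s p)

lemma smoothing_congr_ae {ν : Measure S} {s c : ℝ} {f g : S → ℝ} (h : f =ᵐ[ν] g) :
    smoothing ν s c f = smoothing ν s c g := by
  ext p
  rw [smoothing, smoothing, integral_congr_ae]
  filter_upwards [h] with y hy
  rw [hy]

variable [BorelSpace X] {ν : Measure S} {s c : ℝ} {f : S → ℝ}

lemma measurable_kernel (s : ℝ) (p : X) : Measurable fun y : S => cutoff (dist p y / s) :=
  (continuous_cutoff.comp (by fun_prop)).measurable

lemma norm_cutoff_le (t : ℝ) : ‖cutoff t‖ ≤ 1 := by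
  rw [Real.norm_eq_abs, abs_of_nonneg (cutoff_nonneg t)]
  exact cutoff_le_one t

lemma integrable_kernel_mul (hf : Integrable f ν) (s : ℝ) (p : X) :
    Integrable (fun y : S => cutoff (dist p y / s) * f y) ν :=
  hf.bdd_mul (measurable_kernel s p).aestronglyMeasurable
    (Eventually.of_forall fun _ => norm_cutoff_le _)

lemma smoothing_add {g : S → ℝ} (hf : Integrable f ν) (hg : Integrable g ν) (p : X) :
    smoothing ν s c (f + g) p = smoothing ν s c f p + smoothing ν s c g p := by
  rw [smoothing, smoothing, smoothing, ← add_div, ← integral_add (integrable_kernel_mul hf s p)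
    (integrable_kernel_mul hg s p)]
  simp only [Pi.add_apply, mul_add]

omit [BorelSpace X] in
lemma smoothing_smul (a : ℝ) (p : X) :
    smoothing ν s c (a • f) p = a * smoothing ν s c f p := by
  rw [smoothing, smoothing, ← mul_div_assoc, ← integral_const_mul]
  congr 2
  ext y
  simp only [Pi.smul_apply, smul_eq_mul]
  ring

lemma abs_integral_kernel_mul_le (hf : Integrable f ν) (p : X) :
    |∫ y, cutoff (dist p y / s) * f y ∂ν| ≤ ∫ y, |f y| ∂ν := by
  refine (abs_integral_le_integral_abs).trans ?_
  refine integral_mono (integrable_kernel_mul hf s p).abs hf.abs fun y => ?_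
  simp only [abs_mul, abs_of_nonneg (cutoff_nonneg _)]
  exact mul_le_of_le_one_left (abs_nonneg _) (cutoff_le_one _)

omit [MeasurableSpace X] [BorelSpace X] in
lemma abs_kernel_sub_le (hs : 0 < s) (p q y : X) :
    |cutoff (dist p y / s) - cutoff (dist q y / s)| ≤ dist p q / s := by
  refine (abs_cutoff_sub_le _ _).trans ?_
  rw [← sub_div, abs_div, abs_of_pos hs]
  gcongr
  exact abs_dist_sub_le p q y

lemma abs_integral_kernel_mul_sub_le (hs : 0 < s) (hf : Integrable f ν) (p q : X) :
    |(∫ y, cutoff (dist p y / s) * f y ∂ν) - ∫ y, cutoff (dist q y / s) * f y ∂ν| ≤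
      dist p q / s * ∫ y, |f y| ∂ν := by
  rw [← integral_sub (integrable_kernel_mul hf s p) (integrable_kernel_mul hf s q),
    ← integral_const_mul]
  refine (abs_integral_le_integral_abs).trans ?_
  refine integral_mono ((integrable_kernel_mul hf s p).sub (integrable_kernel_mul hf s q)).abs
    (hf.abs.const_mul _) fun y => ?_
  simp only [← sub_mul, abs_mul]
  gcongr
  exact abs_kernel_sub_le hs p q y

lemma abs_smoothing_le (hc : 0 < c) (hf : Integrable f ν) (p : X) :
    |smoothing ν s c f p| ≤ c⁻¹ * ∫ y, |f y| ∂ν := by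
  rw [smoothing, abs_div, abs_of_pos (lt_of_lt_of_le hc (le_max_left _ _)), div_eq_inv_mul]
  have h1 := abs_integral_kernel_mul_le (s := s) hf p
  gcongr
  exact le_max_left _ _

variable [IsFiniteMeasure ν]

lemma integrable_kernel (s : ℝ) (p : X) :
    Integrable (fun y : S => cutoff (dist p y / s)) ν :=
  Integrable.of_bound (measurable_kernel s p).aestronglyMeasurable 1
    (Eventually.of_forall fun _ => norm_cutoff_le _)

lemma abs_kernelMass_sub_le (hs : 0 < s) (p q : X) :
    |kernelMass ν s p - kernelMass ν s q| ≤ dist p q / s * ν.real univ := by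
  have := abs_integral_kernel_mul_sub_le (ν := ν) (f := fun _ => (1 : ℝ)) hs
    (integrable_const _) p q
  simpa [kernelMass] using this

/-- The quotient rule for differences. Truncating the denominator at c > 0 keeps the bound valid on
all of X, even where the kernel has no mass, and makes it a constant independent of f times
‖f‖_{L¹}. -/
lemma abs_smoothing_sub_le (hs : 0 < s) (hc : 0 < c) (hf : Integrable f ν) (p q : X) :
    |smoothing ν s c f p - smoothing ν s c f q| ≤
      ((s * c)⁻¹ + ν.real univ * (s * c ^ 2)⁻¹) * (∫ y, |f y| ∂ν) * dist p q := by
  set I := ∫ y, |f y| ∂ν with hI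
  have hI0 : 0 ≤ I := integral_nonneg fun _ => abs_nonneg _
  set a := ∫ y, cutoff (dist p y / s) * f y ∂ν
  set a' := ∫ y, cutoff (dist q y / s) * f y ∂ν with ha'
  set b := max c (kernelMass ν s p) with hb
  set b' := max c (kernelMass ν s q) with hb'
  have hbc : c ≤ b := le_max_left _ _
  have hbc' : c ≤ b' := le_max_left _ _
  have hb0 : 0 < b := hc.trans_le hbc
  have hb0' : 0 < b' := hc.trans_le hbc'
  have h1 : |a - a'| ≤ dist p q / s * I := abs_integral_kernel_mul_sub_le hs hf p q
  have h2 : |b' - b| ≤ dist p q / s * ν.real univ := by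
    refine (abs_max_sub_max_le_max _ _ _ _).trans ?_
    rw [sub_self, abs_zero, abs_sub_comm]
    exact max_le (by positivity) (abs_kernelMass_sub_le hs p q)
  have h3 : |a'| ≤ I := abs_integral_kernel_mul_le hf q
  have h4 : a / b - a' / b' = (a - a') / b + a' * (b' - b) / (b * b') := by
    field_simp
    ring
  calc |a / b - a' / b'| ≤ |(a - a') / b| + |a' * (b' - b) / (b * b')| := by
        rw [h4]; exact abs_add_le _ _
    _ = |a - a'| / b + |a'| * |b' - b| / (b * b') := by
        rw [abs_div, abs_div, abs_mul, abs_of_pos hb0, abs_of_pos (mul_pos hb0 hb0')]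
    _ ≤ dist p q / s * I / c + I * (dist p q / s * ν.real univ) / (c * c) := by gcongr
    _ = _ := by field_simp

/-- The kernel equals 1 up to distance s, so ball measures bound its mass from below; this shows
that the truncation is inactive near the boundary. -/
lemma measureReal_le_kernelMass {p : X} {B : Set S} (hs : 0 < s) (hB : MeasurableSet B)
    (h : ∀ y ∈ B, dist p y ≤ s) : ν.real B ≤ kernelMass ν s p := by
  have h1 : ν.real B = ∫ y, B.indicator (fun _ => (1 : ℝ)) y ∂ν := by
    rw [integral_indicator_const _ hB, smul_eq_mul, mul_one]
  rw [h1, kernelMass]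
  refine integral_mono ((integrable_const _).indicator hB) (integrable_kernel s p) fun y => ?_
  by_cases hy : y ∈ B
  · simp only [indicator_of_mem hy]
    rw [cutoff_eq_one ((div_le_one hs).2 (h y hy))]
  · simp only [indicator_of_notMem hy]
    exact cutoff_nonneg _

/-- The deviation of the smoothing from a constant is controlled by the mean deviation of the
function. -/
lemma enorm_smoothing_sub_le (hs : 0 < s) (hf : Integrable f ν) {p : X} {κ : ℝ} (hκ : 0 < κ)
    (hc : c ≤ kernelMass ν s p) (hκN : κ ≤ kernelMass ν s p) (a : ℝ) :
    ‖smoothing ν s c f p - a‖ₑ ≤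
      (ENNReal.ofReal κ)⁻¹ * ∫⁻ y in {y : S | dist p y < 2 * s}, ‖f y - a‖ₑ ∂ν := by
  set N := kernelMass ν s p with hN
  have hN0 : 0 < N := hκ.trans_le hκN
  have hBm : MeasurableSet {y : S | dist p y < 2 * s} :=
    (isOpen_lt (by fun_prop) continuous_const).measurableSet
  -- Where the truncation is inactive the smoothing is a true average, so it reproduces constants.
  have h1 : smoothing ν s c f p - a = N⁻¹ * ∫ y, cutoff (dist p y / s) * (f y - a) ∂ν := by
    have h2 : ∫ y, cutoff (dist p y / s) * (f y - a) ∂ν =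
        (∫ y, cutoff (dist p y / s) * f y ∂ν) - N * a := by
      simp only [mul_sub]
      rw [integral_sub (integrable_kernel_mul hf s p) ((integrable_kernel s p).mul_const a),
        integral_mul_const, hN, kernelMass]
    rw [h2, smoothing, max_eq_right hc]
    field_simp
  rw [h1, enorm_mul]
  refine mul_le_mul' ?_ ?_
  · rw [Real.enorm_eq_ofReal (by positivity), ENNReal.ofReal_inv_of_pos hN0]
    exact ENNReal.inv_le_inv.2 (ENNReal.ofReal_le_ofReal hκN)
  · refine (enorm_integral_le_lintegral_enorm _).trans ?_
    rw [← lintegral_indicator hBm]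
    refine lintegral_mono fun y => ?_
    by_cases hy : dist p y < 2 * s
    · rw [indicator_of_mem (show y ∈ {y : S | dist p y < 2 * s} from hy), enorm_mul]
      refine mul_le_of_le_one_left zero_le ?_
      rw [Real.enorm_eq_ofReal (cutoff_nonneg _), ENNReal.ofReal_le_one]
      exact cutoff_le_one _
    · rw [cutoff_eq_zero ((le_div_iff₀ hs).2 (not_lt.1 hy)), zero_mul, enorm_zero]
      exact zero_le

lemma enorm_smoothing_sub_le_laverage (hs : 0 < s) (hf : Integrable f ν) {p : X}
    (hc : c ≤ kernelMass ν s p) {B : Set S} (hB : MeasurableSet B)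
    (hBs : ∀ y ∈ B, dist p y ≤ s) (hB0 : ν B ≠ 0) (a : ℝ) :
    ‖smoothing ν s c f p - a‖ₑ ≤
      (ν B)⁻¹ * ∫⁻ y in {y : S | dist p y < 2 * s}, ‖f y - a‖ₑ ∂ν := by
  have h := enorm_smoothing_sub_le hs hf (κ := ν.real B)
    (ENNReal.toReal_pos hB0 (measure_ne_top _ _)) hc (measureReal_le_kernelMass hs hB hBs) a
  rwa [ofReal_measureReal] at h

end Smoothing

/-! ### The Besov energy as an integral over scales -/

section Oscillation

variable {Z : Type*} [MetricSpace Z] [MeasurableSpace Z]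

/-- The mean oscillation `∫_Z ⨍_{B(x,t)} |u(y) - u(x)| dν(y) dν(x)` of `u` at scale `t`. -/
noncomputable def meanOscillation (ν : Measure Z) (u : Z → ℝ) (t : ℝ) : ℝ≥0∞ :=
  ∫⁻ x, ⨍⁻ y in Metric.ball x t, ‖u y - u x‖ₑ ∂ν ∂ν

lemma besovEnergy_zero_eq (ν : Measure Z) (R : ℝ) (u : Z → ℝ) :
    besovEnergy ν 0 R u = ∫⁻ t in Ioo (0 : ℝ) R, meanOscillation ν u t / ENNReal.ofReal t := by
  simp [besovEnergy, meanOscillation]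

lemma meanOscillation_congr_ae {ν : Measure Z} {u v : Z → ℝ} (h : u =ᵐ[ν] v) (t : ℝ) :
    meanOscillation ν u t = meanOscillation ν v t := by
  refine lintegral_congr_ae ?_
  filter_upwards [h] with x hx
  rw [setLAverage_eq, setLAverage_eq]
  congr 1
  refine lintegral_congr_ae (ae_restrict_of_ae ?_)
  filter_upwards [h] with y hy
  rw [hx, hy]

lemma besovNorm_congr_ae {ν : Measure Z} {R : ℝ} {u v : Z → ℝ} (h : u =ᵐ[ν] v) :
    besovNorm ν 0 R u = besovNorm ν 0 R v := by
  rw [besovNorm, besovNorm, eLpNorm_congr_ae h, besovEnergy_zero_eq, besovEnergy_zero_eq]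
  simp_rw [meanOscillation_congr_ae h]

variable [BorelSpace Z] [SecondCountableTopology Z] {ν : Measure Z} [IsFiniteMeasure ν]

/-- The varying ball is a section of an open subset of a product, so numerator and denominator are
integrals depending measurably on the parameters (t, x). -/
lemma measurable_setLAverage_ball {u : Z → ℝ} (hu : Measurable u) :
    Measurable fun w : ℝ × Z => ⨍⁻ y in Metric.ball w.2 w.1, ‖u y - u w.2‖ₑ ∂ν := by
  have hT : MeasurableSet {v : (ℝ × Z) × Z | dist v.2 v.1.2 < v.1.1} :=
    (isOpen_lt (by fun_prop) (by fun_prop)).measurableSet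
  have h1 : Measurable fun w : ℝ × Z => ν (Metric.ball w.2 w.1) :=
    measurable_measure_prodMk_left (ν := ν) hT
  have h2 : Measurable fun w : ℝ × Z => ∫⁻ y in Metric.ball w.2 w.1, ‖u y - u w.2‖ₑ ∂ν := by
    have h3 : Measurable fun w : ℝ × Z => ∫⁻ y,
        {v : (ℝ × Z) × Z | dist v.2 v.1.2 < v.1.1}.indicator
          (fun v => ‖u v.2 - u v.1.2‖ₑ) (w, y) ∂ν := by
      refine Measurable.lintegral_prod_right' (Measurable.indicator ?_ hT)
      exact ((hu.comp measurable_snd).sub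
        (hu.comp (measurable_snd.comp measurable_fst))).enorm
    convert h3 using 2 with w
    rw [← lintegral_indicator Metric.isOpen_ball.measurableSet]
    rfl
  simp_rw [setLAverage_eq]
  exact h2.div h1

lemma measurable_meanOscillation {u : Z → ℝ} (hu : Measurable u) :
    Measurable (meanOscillation ν u) :=
  Measurable.lintegral_prod_right' (measurable_setLAverage_ball hu)

lemma meanOscillation_add_le {u v : Z → ℝ} (hu : Measurable u) (t : ℝ) :
    meanOscillation ν (u + v) t ≤ meanOscillation ν u t + meanOscillation ν v t := by
  have hm : Measurable fun x => ⨍⁻ y in Metric.ball x t, ‖u y - u x‖ₑ ∂ν := by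
    have h : Measurable fun x : Z => (t, x) := measurable_prodMk_left
    have h' := (measurable_setLAverage_ball (ν := ν) hu).comp h
    simp only [Function.comp_def] at h'
    exact h'
  rw [meanOscillation, meanOscillation, meanOscillation, ← lintegral_add_left hm]
  refine lintegral_mono fun x => ?_
  simp only [setLAverage_eq]
  rw [← ENNReal.add_div, ← lintegral_add_left (hu.sub_const _).enorm]
  refine ENNReal.div_le_div_right (lintegral_mono fun y => ?_) _
  simp only [Pi.add_apply]
  rw [add_sub_add_comm]
  exact enorm_add_le _ _

omit [BorelSpace Z] [SecondCountableTopology Z] [IsFiniteMeasure ν] in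
lemma meanOscillation_smul (a : ℝ) (u : Z → ℝ) (t : ℝ) :
    meanOscillation ν (a • u) t = ‖a‖ₑ * meanOscillation ν u t := by
  have h : ∀ x y, ‖(a • u) y - (a • u) x‖ₑ = ‖a‖ₑ * ‖u y - u x‖ₑ := fun x y => by
    rw [Pi.smul_apply, Pi.smul_apply, ← smul_sub, enorm_smul]
  simp_rw [meanOscillation, setLAverage_eq, h]
  simp_rw [lintegral_const_mul' _ _ (enorm_ne_top (x := a)), mul_div_assoc]
  rw [lintegral_const_mul' _ _ enorm_ne_top]

lemma besovEnergy_add_le {u v : Z → ℝ} (hu : Measurable u) (R : ℝ) :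
    besovEnergy ν 0 R (u + v) ≤ besovEnergy ν 0 R u + besovEnergy ν 0 R v := by
  have hm : Measurable fun t => meanOscillation ν u t / ENNReal.ofReal t :=
    (measurable_meanOscillation hu).div ENNReal.measurable_ofReal
  rw [besovEnergy_zero_eq, besovEnergy_zero_eq, besovEnergy_zero_eq, ← lintegral_add_left hm]
  refine lintegral_mono fun t => ?_
  rw [← ENNReal.add_div]
  exact ENNReal.div_le_div_right (meanOscillation_add_le hu t) _

omit [BorelSpace Z] [SecondCountableTopology Z] [IsFiniteMeasure ν] in
lemma besovEnergy_smul (a : ℝ) (u : Z → ℝ) (R : ℝ) :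
    besovEnergy ν 0 R (a • u) = ‖a‖ₑ * besovEnergy ν 0 R u := by
  rw [besovEnergy_zero_eq, besovEnergy_zero_eq, ← lintegral_const_mul' _ _ enorm_ne_top]
  refine lintegral_congr fun t => ?_
  rw [meanOscillation_smul, mul_div_assoc]

variable (ν) in
/-- The Besov space `B^0_{1,1}` as a subspace of `L¹`. -/
noncomputable def besovSubmodule (R : ℝ) : Submodule ℝ (Lp ℝ 1 ν) where
  carrier := besovSpace ν 0 R
  zero_mem' := by
    change besovNorm ν 0 R _ < ∞
    rw [besovNorm_congr_ae (Lp.coeFn_zero ℝ 1 ν)]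
    simp [besovNorm, besovEnergy_zero_eq, meanOscillation]
  add_mem' := by
    intro u v hu hv
    change besovNorm ν 0 R _ < ∞
    rw [besovNorm_congr_ae (Lp.coeFn_add u v)]
    have hu' : besovNorm ν 0 R u < ∞ := hu
    have hv' : besovNorm ν 0 R v < ∞ := hv
    rw [besovNorm, ENNReal.add_lt_top] at hu' hv' ⊢
    have hm := (Lp.stronglyMeasurable u).measurable
    exact ⟨(eLpNorm_add_le (Lp.aestronglyMeasurable u) (Lp.aestronglyMeasurable v) le_rfl).trans_lt
      (ENNReal.add_lt_top.2 ⟨hu'.1, hv'.1⟩),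
      (besovEnergy_add_le hm R).trans_lt (ENNReal.add_lt_top.2 ⟨hu'.2, hv'.2⟩)⟩
  smul_mem' := by
    intro a u hu
    change besovNorm ν 0 R _ < ∞
    rw [besovNorm_congr_ae (Lp.coeFn_smul a u)]
    have hu' : besovNorm ν 0 R u < ∞ := hu
    rw [besovNorm, ENNReal.add_lt_top] at hu' ⊢
    rw [besovEnergy_smul, eLpNorm_const_smul]
    exact ⟨ENNReal.mul_lt_top enorm_lt_top hu'.1, ENNReal.mul_lt_top enorm_lt_top hu'.2⟩

/-! ### Passing from single dyadic scales to the integral over scales -/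

section Scales

variable {A : ℝ≥0} {D : ℝ} (hA : ∀ (x : Z) (r : ℝ), 0 < r → r ≤ D →
  ν (Metric.ball x (2 * r)) ≤ A * ν (Metric.ball x r))

include hA

omit [BorelSpace Z] [SecondCountableTopology Z] in
-- B(x, t) lies between B(x, r) and B(x, 2r), so doubling makes the two normalizations comparable.
lemma meanOscillation_le_mul {u : Z → ℝ} (hpos : ∀ (x : Z) (r : ℝ), 0 < r → 0 < ν (Metric.ball x r))
    {r t : ℝ} (hr : 0 < r) (hrD : r ≤ D) (hrt : r ≤ t) (htr : t ≤ 2 * r) :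
    meanOscillation ν u r ≤ A * meanOscillation ν u t := by
  rw [meanOscillation, meanOscillation, ← lintegral_const_mul' _ _ ENNReal.coe_ne_top]
  refine lintegral_mono fun x => ?_
  rw [setLAverage_eq, setLAverage_eq]
  have ht0 : ν (Metric.ball x t) ≠ 0 := (hpos x t (hr.trans_le hrt)).ne'
  have hr0 : ν (Metric.ball x r) ≠ 0 := (hpos x r hr).ne'
  have h1 : ν (Metric.ball x t) ≤ A * ν (Metric.ball x r) :=
    (measure_mono (Metric.ball_subset_ball htr)).trans (hA x r hr hrD)
  have h2 : (ν (Metric.ball x r))⁻¹ ≤ A * (ν (Metric.ball x t))⁻¹ := by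
    rw [← div_eq_mul_inv, ENNReal.le_div_iff_mul_le (Or.inl ht0) (Or.inl (measure_ne_top _ _)),
      ← ENNReal.div_eq_inv_mul, ENNReal.div_le_iff_le_mul (Or.inl hr0)
        (Or.inl (measure_ne_top _ _))]
    exact h1
  calc (∫⁻ y in Metric.ball x r, ‖u y - u x‖ₑ ∂ν) / ν (Metric.ball x r)
      ≤ (∫⁻ y in Metric.ball x t, ‖u y - u x‖ₑ ∂ν) * (A * (ν (Metric.ball x t))⁻¹) := by
        rw [div_eq_mul_inv]
        gcongr
    _ = A * ((∫⁻ y in Metric.ball x t, ‖u y - u x‖ₑ ∂ν) / ν (Metric.ball x t)) := by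
        rw [div_eq_mul_inv]; ring

omit [BorelSpace Z] [SecondCountableTopology Z] in
-- On (r, 2r) the density 1/t is at least 1/(2r), so this interval has dt/t-mass at least 1/2; hence
-- the factor 2.
lemma meanOscillation_le_lintegral {u : Z → ℝ}
    (hpos : ∀ (x : Z) (r : ℝ), 0 < r → 0 < ν (Metric.ball x r))
    {r : ℝ} (hr : 0 < r) (hrD : r ≤ D) :
    meanOscillation ν u r ≤
      2 * A * ∫⁻ t in Ioo r (2 * r), meanOscillation ν u t / ENNReal.ofReal t := by
  have h2r : ENNReal.ofReal (2 * r) ≠ 0 := by simpa using hr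
  calc meanOscillation ν u r
      = 2 * ∫⁻ t in Ioo r (2 * r), meanOscillation ν u r / ENNReal.ofReal (2 * r) := by
        rw [setLIntegral_const, Real.volume_Ioo, show 2 * r - r = r by ring,
          ENNReal.ofReal_mul zero_le_two, ENNReal.ofReal_ofNat, mul_comm, mul_assoc, mul_comm _ 2,
          ENNReal.div_mul_cancel]
        · simpa using hr
        · exact ENNReal.mul_ne_top ENNReal.ofNat_ne_top ENNReal.ofReal_ne_top
    _ ≤ 2 * ∫⁻ t in Ioo r (2 * r), A * (meanOscillation ν u t / ENNReal.ofReal t) := by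
        refine mul_le_mul_right (setLIntegral_mono' measurableSet_Ioo fun t ht => ?_) _
        rw [← mul_div_assoc]
        exact ENNReal.div_le_div (meanOscillation_le_mul hA hpos hr hrD ht.1.le ht.2.le)
          (ENNReal.ofReal_le_ofReal ht.2.le)
    _ = _ := by rw [lintegral_const_mul' _ _ ENNReal.coe_ne_top, mul_assoc]

omit [BorelSpace Z] [SecondCountableTopology Z] in
/-- The mean oscillations at dyadic scales are controlled by the Besov energy. -/
lemma tsum_meanOscillation_le {u : Z → ℝ}
    (hpos : ∀ (x : Z) (r : ℝ), 0 < r → 0 < ν (Metric.ball x r))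
    {r R : ℝ} (hr : 0 < r) (hrD : r ≤ D) (hrR : 2 * r ≤ R) :
    ∑' k : ℕ, meanOscillation ν u (r / 2 ^ k) ≤ 2 * A * besovEnergy ν 0 R u := by
  have hrk : ∀ k : ℕ, r / 2 ^ k ≤ r := fun k => div_le_self hr.le (one_le_pow₀ one_le_two)
  -- Consecutive intervals (r/2^k, 2r/2^k) at most share end points, so their integrals add up
  -- without overlap.
  have hmono : ∀ j k : ℕ, j < k → 2 * (r / 2 ^ k) ≤ r / 2 ^ j := by
    intro j k hjk
    have h2 : (2 : ℝ) ^ (j + 1) ≤ 2 ^ k := pow_le_pow_right₀ one_le_two hjk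
    rw [← mul_div_assoc, div_le_div_iff₀ (by positivity) (by positivity)]
    rw [pow_succ] at h2
    nlinarith
  calc ∑' k : ℕ, meanOscillation ν u (r / 2 ^ k)
      ≤ ∑' k : ℕ, 2 * A * ∫⁻ t in Ioo (r / 2 ^ k) (2 * (r / 2 ^ k)),
          meanOscillation ν u t / ENNReal.ofReal t :=
        ENNReal.tsum_le_tsum fun k =>
          meanOscillation_le_lintegral hA hpos (by positivity) ((hrk k).trans hrD)
    _ = 2 * A * ∫⁻ t in ⋃ k : ℕ, Ioo (r / 2 ^ k) (2 * (r / 2 ^ k)),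
          meanOscillation ν u t / ENNReal.ofReal t := by
        rw [ENNReal.tsum_mul_left, lintegral_iUnion fun k => measurableSet_Ioo]
        intro j k hjk
        refine Set.disjoint_left.2 fun t htj htk => ?_
        rcases lt_or_gt_of_ne hjk with h | h
        · linarith [hmono j k h, htj.1, htk.2]
        · linarith [hmono k j h, htk.1, htj.2]
    _ ≤ 2 * A * besovEnergy ν 0 R u := by
        rw [besovEnergy_zero_eq]
        gcongr
        refine iUnion_subset fun k t ht => ⟨?_, ?_⟩
        · exact lt_trans (by positivity) ht.1
        · linarith [ht.2, hrk k]

end Scales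

end Oscillation

section SmoothingError

variable {X : Type*} [MetricSpace X] [MeasurableSpace X] [BorelSpace X] {S : Set X}
  {ν : Measure S} [IsFiniteMeasure ν]

/-- The kernel at x lives in B(x, 2s) and has mass at least ν(B(x, s)). Doubling turns this into the
average over B(x, 2s). -/
lemma lintegral_smoothing_sub_le {A : ℝ≥0} {s c : ℝ} {f : S → ℝ} (hs : 0 < s)
    (hf : Integrable f ν) (hpos : ∀ x : S, 0 < ν (Metric.ball x s))
    (hA : ∀ x : S, ν (Metric.ball x (2 * s)) ≤ A * ν (Metric.ball x s))
    (hc : ∀ x : S, c ≤ kernelMass ν s (x : X)) :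
    ∫⁻ x, ‖smoothing ν s c f (x : X) - f x‖ₑ ∂ν ≤ A * meanOscillation ν f (2 * s) := by
  rw [meanOscillation, ← lintegral_const_mul' _ _ ENNReal.coe_ne_top]
  refine lintegral_mono fun x => ?_
  have h0 : ν (Metric.ball x s) ≠ 0 := (hpos x).ne'
  have h2 : ν (Metric.ball x (2 * s)) ≠ 0 := ((hpos x).trans_le
    (measure_mono (Metric.ball_subset_ball (by linarith)))).ne'
  have h := enorm_smoothing_sub_le_laverage hs hf (hc x) (B := Metric.ball x s)
    Metric.isOpen_ball.measurableSet
    (fun y hy => by rw [Metric.mem_ball, dist_comm] at hy; exact hy.le) h0 (f x)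
  have hset : {y : S | dist (x : X) y < 2 * s} = Metric.ball x (2 * s) := by
    ext y
    rw [Metric.mem_ball, dist_comm]
    rfl
  rw [hset] at h
  refine h.trans ?_
  rw [setLAverage_eq, div_eq_mul_inv, mul_comm (∫⁻ y in _, _ ∂ν), ← mul_assoc]
  gcongr
  rw [← div_eq_mul_inv, ENNReal.le_div_iff_mul_le (Or.inl h2) (Or.inl (measure_ne_top _ _)),
    ← ENNReal.div_eq_inv_mul, ENNReal.div_le_iff_le_mul (Or.inl h0) (Or.inl (measure_ne_top _ _))]
  exact hA x

end SmoothingError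

/-! ### Boundary layers -/

/-- A running minimum of the thresholds decreases and stays in each admissible interval, so a single
decreasing sequence meets countably many smallness conditions. -/
lemma exists_antitone_of_eventually {P : ℕ → ℝ → Prop} (h : ∀ k, ∀ᶠ ρ in 𝓝[>] (0 : ℝ), P k ρ) :
    ∃ ρ : ℕ → ℝ, Antitone ρ ∧ ∀ k, 0 < ρ k ∧ P k (ρ k) := by
  have h' : ∀ k, ∃ δ > (0 : ℝ), Ioc 0 δ ⊆ {ρ | P k ρ} := fun k =>
    (mem_nhdsGT_iff_exists_Ioc_subset).1 (h k)
  choose δ hδ hP using h'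
  let ρ : ℕ → ℝ := fun k => Nat.rec (δ 0) (fun j r => min r (δ (j + 1))) k
  have hsucc : ∀ k, ρ (k + 1) = min (ρ k) (δ (k + 1)) := fun k => rfl
  have hpos : ∀ k, 0 < ρ k := by
    intro k
    induction k with
    | zero => exact hδ 0
    | succ k ih => rw [hsucc]; exact lt_min ih (hδ _)
  have hle : ∀ k, ρ k ≤ δ k := by
    intro k
    cases k with
    | zero => exact le_rfl
    | succ k => rw [hsucc]; exact min_le_right _ _
  exact ⟨ρ, antitone_nat_of_succ_le fun k => by rw [hsucc]; exact min_le_left _ _,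
    fun k => ⟨hpos k, hP k ⟨hpos k, hle k⟩⟩⟩

/-- A monotone set function which is positive on balls centred in a totally bounded set is bounded
from below on balls of a fixed radius. -/
lemma exists_lower_bound_ball {X : Type*} [MetricSpace X] {S : Set X} {Φ : Set X → ℝ≥0∞}
    (hΦ : Monotone Φ) (hpos : ∀ x ∈ S, ∀ r, 0 < r → 0 < Φ (Metric.ball x r))
    (hcov : ∀ ε > 0, ∃ N : Set X, N ⊆ S ∧ N.Finite ∧ S ⊆ ⋃ x ∈ N, Metric.ball x ε)
    {r : ℝ} (hr : 0 < r) : ∃ b : ℝ≥0∞, 0 < b ∧ ∀ x ∈ S, b ≤ Φ (Metric.ball x r) := by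
  -- A ball of radius r contains the ball of radius r/2 about a nearby point of a finite r/2-net.
  obtain ⟨N, hNS, hN, hcovN⟩ := hcov (r / 2) (by positivity)
  refine ⟨hN.toFinset.inf fun x => Φ (Metric.ball x (r / 2)), ?_, fun x hx => ?_⟩
  · rw [Finset.lt_inf_iff ENNReal.zero_lt_top]
    exact fun x hx => hpos x (hNS (hN.mem_toFinset.1 hx)) _ (by positivity)
  · obtain ⟨y, hy, hxy⟩ := mem_iUnion₂.1 (hcovN hx)
    refine (Finset.inf_le (hN.mem_toFinset.2 hy)).trans (hΦ (Metric.ball_subset_ball' ?_))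
    rw [Metric.mem_ball, dist_comm] at hxy
    linarith

section Layering

variable {X : Type*} [MetricSpace X] [MeasurableSpace X]

/-- The smoothings at the scales `s 0, s 1, …`, preceded by the zero function. -/
noncomputable def smoothingSeq {S : Set X} (ν : Measure S) (s c : ℕ → ℝ) (f : S → ℝ) :
    ℕ → X → ℝ
  | 0 => 0
  | k + 1 => smoothing ν (s k) (c k) f

/-- The difference of two successive smoothings. -/
noncomputable def smoothingDiff {S : Set X} (ν : Measure S) (s c : ℕ → ℝ) (f : S → ℝ)
    (k : ℕ) (p : X) : ℝ :=
  smoothingSeq ν s c f (k + 1) p - smoothingSeq ν s c f k p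

/-- The extension which equals a smoothing at scale `s k` in the boundary layer of thickness
comparable to `ρ k`. -/
noncomputable def layeredExtension {S : Set X} (ν : Measure S) (s c ρ : ℕ → ℝ) (f : S → ℝ)
    (p : X) : ℝ :=
  ∑' k, cutoff (2 * Metric.infDist p S / ρ k) * smoothingDiff ν s c f k p

/-- A bound for the supremum and the Lipschitz constant of a smoothing. -/
noncomputable def smoothingBound {S : Set X} (ν : Measure S) (s c : ℝ) : ℝ :=
  c⁻¹ + ((s * c)⁻¹ + ν.real univ * (s * c ^ 2)⁻¹)

/-- A bound for the supremum and the Lipschitz constant of `smoothingDiff`. -/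
noncomputable def diffBound {S : Set X} (ν : Measure S) (s c : ℕ → ℝ) : ℕ → ℝ
  | 0 => smoothingBound ν (s 0) (c 0)
  | k + 1 => smoothingBound ν (s (k + 1)) (c (k + 1)) + smoothingBound ν (s k) (c k)

/-! ### Bounds in terms of the L¹ norm, with constants independent of f -/

section Bounds

variable {S : Set X} {ν : Measure S} {s c : ℕ → ℝ} (hs : ∀ k, 0 < s k) (hc : ∀ k, 0 < c k)
include hs hc

omit [MetricSpace X] in
lemma smoothingBound_nonneg (k : ℕ) : 0 ≤ smoothingBound ν (s k) (c k) := by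
  have h1 := hs k
  have h2 := hc k
  unfold smoothingBound
  positivity

omit [MetricSpace X] in
-- Lets the smallness conditions stated with `diffBound` also absorb the crude factor 1/c k in the
-- trace estimate.
lemma inv_le_diffBound (k : ℕ) : (c k)⁻¹ ≤ diffBound ν s c k := by
  have h1 := hs k
  have h2 := hc k
  have h3 : (c k)⁻¹ ≤ smoothingBound ν (s k) (c k) := by
    unfold smoothingBound
    exact le_add_of_nonneg_right (by positivity)
  cases k with
  | zero => exact h3
  | succ k => exact h3.trans (le_add_of_nonneg_right (smoothingBound_nonneg hs hc k))

omit [MetricSpace X] in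
lemma diffBound_nonneg (k : ℕ) : 0 ≤ diffBound ν s c k :=
  (inv_nonneg.2 (hc k).le).trans (inv_le_diffBound hs hc k)

variable [BorelSpace X] {f : S → ℝ} (hf : Integrable f ν)
include hf

lemma abs_smoothing_le_smoothingBound (k : ℕ) (p : X) :
    |smoothing ν (s k) (c k) f p| ≤ smoothingBound ν (s k) (c k) * ∫ y, |f y| ∂ν := by
  have h1 := hs k
  have h2 := hc k
  refine (abs_smoothing_le (hc k) hf p).trans ?_
  refine mul_le_mul_of_nonneg_right ?_ (integral_nonneg fun _ => abs_nonneg _)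
  unfold smoothingBound
  exact le_add_of_nonneg_right (by positivity)

lemma abs_smoothingDiff_le (k : ℕ) (p : X) :
    |smoothingDiff ν s c f k p| ≤ diffBound ν s c k * ∫ y, |f y| ∂ν := by
  cases k with
  | zero => simpa [smoothingDiff, smoothingSeq, diffBound] using
      abs_smoothing_le_smoothingBound hs hc hf 0 p
  | succ k =>
    simp only [smoothingDiff, smoothingSeq, diffBound, add_mul]
    exact (abs_sub _ _).trans (add_le_add (abs_smoothing_le_smoothingBound hs hc hf (k + 1) p)
      (abs_smoothing_le_smoothingBound hs hc hf k p))

variable [IsFiniteMeasure ν]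

lemma abs_smoothing_sub_le_smoothingBound (k : ℕ) (p q : X) :
    |smoothing ν (s k) (c k) f p - smoothing ν (s k) (c k) f q| ≤
      smoothingBound ν (s k) (c k) * (∫ y, |f y| ∂ν) * dist p q := by
  have h2 := hc k
  refine (abs_smoothing_sub_le (hs k) (hc k) hf p q).trans ?_
  refine mul_le_mul_of_nonneg_right (mul_le_mul_of_nonneg_right ?_
    (integral_nonneg fun _ => abs_nonneg _)) dist_nonneg
  unfold smoothingBound
  exact le_add_of_nonneg_left (by positivity)

lemma abs_smoothingDiff_sub_le (k : ℕ) (p q : X) :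
    |smoothingDiff ν s c f k p - smoothingDiff ν s c f k q| ≤
      diffBound ν s c k * (∫ y, |f y| ∂ν) * dist p q := by
  cases k with
  | zero => simpa [smoothingDiff, smoothingSeq, diffBound] using
      abs_smoothing_sub_le_smoothingBound hs hc hf 0 p q
  | succ k =>
    simp only [smoothingDiff, smoothingSeq, diffBound, add_mul]
    rw [sub_sub_sub_comm]
    exact (abs_sub _ _).trans (add_le_add
      (abs_smoothing_sub_le_smoothingBound hs hc hf (k + 1) p q)
      (abs_smoothing_sub_le_smoothingBound hs hc hf k p q))

end Bounds

variable [BorelSpace X] {μ : Measure X} {Ω : Set X}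

/-- Scales `s k`, truncation levels `c k` and thicknesses `ρ k` of boundary layers for which the
layered extension is bounded and has the right trace. -/
structure IsLayering (μ : Measure X) (Ω : Set X) (D : ℝ) (s c ρ : ℕ → ℝ) : Prop where
  scale_eq : ∀ k, s k = s 0 / 2 ^ k
  scale_pos : ∀ k, 0 < s k
  scale_le : 2 * s 0 ≤ D
  level_pos : ∀ k, 0 < c k
  level_le : ∀ (k : ℕ) (p : X) (x : frontier Ω), dist p x ≤ s k / 2 →
    c k ≤ kernelMass (boundaryMeasure μ Ω) (s k) p
  thickness_pos : ∀ k, 0 < ρ k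
  thickness_antitone : Antitone ρ
  thickness_tendsto : Tendsto ρ atTop (𝓝 0)
  thickness_le : ∀ k, 2 * ρ k ≤ D
  thickness_le_scale : ∀ k, ρ k ≤ s k / 2
  layer_le : ∀ k, ENNReal.ofReal (diffBound (boundaryMeasure μ Ω) s c k) *
    domainMeasure μ Ω {p : Ω | Metric.infDist (p : X) (frontier Ω) < 2 * ρ k} ≤ 2⁻¹ ^ k
  layer_le_ball : ∀ k, ∀ z ∈ frontier Ω,
    ENNReal.ofReal (diffBound (boundaryMeasure μ Ω) s c k) *
      domainMeasure μ Ω {p : Ω | Metric.infDist (p : X) (frontier Ω) < 2 * ρ k} ≤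
        2⁻¹ ^ k * domainMeasure μ Ω (Subtype.val ⁻¹' Metric.ball z (s k / 2))
  mul_thickness_le : ∀ k, ENNReal.ofReal (diffBound (boundaryMeasure μ Ω) s c k * ρ k) *
    boundaryMeasure μ Ω univ ≤ 2⁻¹ ^ k

omit [MeasurableSpace X] [BorelSpace X] in
lemma infDist_frontier_pos (hΩ : IsOpen Ω) (hne : (frontier Ω).Nonempty) (p : Ω) :
    0 < Metric.infDist (p : X) (frontier Ω) := by
  rw [← isClosed_frontier.notMem_iff_infDist_pos hne, hΩ.frontier_eq]
  exact fun h => h.2 p.2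

/-- Continuity from above: every point of Ω has positive depth, so the layers decrease to the empty
set. No rate is needed. -/
lemma tendsto_domainMeasure_layer (hΩ : IsOpen Ω) (hne : (frontier Ω).Nonempty)
    [IsFiniteMeasure (domainMeasure μ Ω)] :
    Tendsto (fun ρ : ℝ => domainMeasure μ Ω {p : Ω | Metric.infDist (p : X) (frontier Ω) < 2 * ρ})
      (𝓝[>] 0) (𝓝 0) := by
  have hcont : Continuous fun p : Ω => Metric.infDist (p : X) (frontier Ω) :=
    (Metric.continuous_infDist_pt _).comp continuous_subtype_val
  have h := tendsto_measure_biInter_gt (μ := domainMeasure μ Ω) (a := (0 : ℝ))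
    (s := fun ρ : ℝ => {p : Ω | Metric.infDist (p : X) (frontier Ω) < 2 * ρ})
    (fun ρ _ => (isOpen_lt hcont continuous_const).measurableSet.nullMeasurableSet)
    (fun i j _ hij p hp => by rw [mem_ofPred_eq] at hp ⊢; linarith)
    ⟨1, one_pos, measure_ne_top _ _⟩
  have hempty : ⋂ r > (0 : ℝ), {p : Ω | Metric.infDist (p : X) (frontier Ω) < 2 * r} = ∅ := by
    refine eq_empty_of_forall_notMem fun p hp => ?_
    have hpos := infDist_frontier_pos hΩ hne p
    have := mem_iInter₂.1 hp (Metric.infDist (p : X) (frontier Ω) / 2) (by simpa using hpos)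
    rw [mem_ofPred_eq] at this
    linarith
  rw [hempty, measure_empty] at h
  exact h

/-- The order of choice matters: first the scales, then the levels c from total boundedness of ∂Ω,
which fix `diffBound`, and only then ρ, to satisfy finitely many smallness conditions for each k. -/
lemma BoundaryEstimates.exists_isLayering {A : ℝ≥0} {D : ℝ} (h : BoundaryEstimates μ Ω A D)
    (hΩ : IsOpen Ω) {R : ℝ} (hR : 0 < R) :
    ∃ s c ρ, IsLayering μ Ω D s c ρ ∧ 4 * s 0 ≤ R := by
  have := h.isFinite_boundary
  have := h.isFinite_domain
  have hD := h.pos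
  -- R/4 keeps the intervals (2 s k, 4 s k) of the energy integral inside (0, R); D/2 keeps doubling
  -- available at radius 2 s 0.
  obtain ⟨s, hs⟩ : ∃ s : ℕ → ℝ, ∀ k, s k = min (R / 4) (D / 2) / 2 ^ k := ⟨_, fun _ => rfl⟩
  have hs0 : s 0 = min (R / 4) (D / 2) := by simp [hs]
  have hspos : ∀ k, 0 < s k := by
    intro k
    rw [hs]
    have : 0 < min (R / 4) (D / 2) := by positivity
    positivity
  have hc : ∀ k, ∃ c : ℝ, 0 < c ∧ ∀ x : frontier Ω,
      c ≤ (boundaryMeasure μ Ω).real (Metric.ball x (s k / 2)) := by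
    intro k
    obtain ⟨b, hb, hb'⟩ := exists_lower_bound_ball
      (Φ := fun T => boundaryMeasure μ Ω (Subtype.val ⁻¹' T))
      (fun _ _ hST => measure_mono (preimage_mono hST))
      (fun x hx r hr => h.ball_pos ⟨x, hx⟩ r hr) h.exists_finite_cover (half_pos (hspos k))
    obtain ⟨x₀, hx₀⟩ := h.nonempty
    have hbt : b ≠ ∞ := ((hb' x₀ hx₀).trans_lt (measure_lt_top _ _)).ne
    exact ⟨b.toReal, ENNReal.toReal_pos hb.ne' hbt, fun x =>
      ENNReal.toReal_mono (measure_ne_top _ _) (hb' x x.2)⟩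
  choose c hcpos hc using hc
  have hb : ∀ k, ∃ b : ℝ≥0∞, 0 < b ∧ ∀ x ∈ frontier Ω,
      b ≤ domainMeasure μ Ω (Subtype.val ⁻¹' Metric.ball x (s k / 2)) := fun k =>
    exists_lower_bound_ball (Φ := fun T => domainMeasure μ Ω (Subtype.val ⁻¹' T))
      (fun _ _ hST => measure_mono (preimage_mono hST))
      (fun x hx r hr => h.domain_ball_pos ⟨x, hx⟩ r hr) h.exists_finite_cover (half_pos (hspos k))
  choose b hbpos hb using hb
  set M := diffBound (boundaryMeasure μ Ω) s c with hM
  have h2 : ∀ k : ℕ, (0 : ℝ≥0∞) < 2⁻¹ ^ k := fun k =>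
    ENNReal.pow_pos (ENNReal.inv_pos.2 ENNReal.ofNat_ne_top) k
  -- The factor min 1 (b k) yields the absolute bound and the bound relative to balls about boundary
  -- points together.
  have hev : ∀ k, ∀ᶠ ρ in 𝓝[>] (0 : ℝ), 2 * ρ ≤ D ∧ ρ ≤ s k / 2 ∧ ρ ≤ (1 / 2) ^ k ∧
      ENNReal.ofReal (M k) *
        domainMeasure μ Ω {p : Ω | Metric.infDist (p : X) (frontier Ω) < 2 * ρ} ≤
          2⁻¹ ^ k * min 1 (b k) ∧
      ENNReal.ofReal (M k * ρ) * boundaryMeasure μ Ω univ ≤ 2⁻¹ ^ k := by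
    intro k
    have hsmall : ∀ a : ℝ, 0 < a → ∀ᶠ ρ in 𝓝[>] (0 : ℝ), ρ ≤ a := fun a ha =>
      mem_of_superset (Ioc_mem_nhdsGT ha) fun ρ hρ => hρ.2
    have e4 : Tendsto (fun ρ : ℝ => ENNReal.ofReal (M k) *
        domainMeasure μ Ω {p : Ω | Metric.infDist (p : X) (frontier Ω) < 2 * ρ})
        (𝓝[>] 0) (𝓝 0) := by
      simpa using ENNReal.Tendsto.const_mul (tendsto_domainMeasure_layer hΩ h.nonempty)
        (Or.inr (ENNReal.ofReal_ne_top (r := M k)))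
    have e5 : Tendsto (fun ρ : ℝ => ENNReal.ofReal (M k * ρ) * boundaryMeasure μ Ω univ)
        (𝓝[>] 0) (𝓝 0) := by
      have h1 : Tendsto (fun ρ : ℝ => ENNReal.ofReal (M k * ρ)) (𝓝[>] 0) (𝓝 0) := by
        have : Continuous fun ρ : ℝ => ENNReal.ofReal (M k * ρ) :=
          ENNReal.continuous_ofReal.comp (by fun_prop)
        simpa using (this.tendsto 0).mono_left nhdsWithin_le_nhds
      simpa using ENNReal.Tendsto.mul_const h1 (Or.inr (measure_ne_top (boundaryMeasure μ Ω) univ))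
    filter_upwards [hsmall (D / 2) (by positivity), hsmall (s k / 2) (half_pos (hspos k)),
      hsmall ((1 / 2) ^ k) (by positivity),
      e4.eventually_le_const (ENNReal.mul_pos (h2 k).ne' (lt_min one_pos (hbpos k)).ne'),
      e5.eventually_le_const (h2 k)] with ρ g1 g2 g3 g4 g5
    exact ⟨by linarith, g2, g3, g4, g5⟩
  obtain ⟨ρ, hanti, hρ⟩ := exists_antitone_of_eventually hev
  refine ⟨s, c, ρ, ⟨fun k => by rw [hs k, hs0], hspos, ?_, hcpos, ?_, fun k => (hρ k).1, hanti, ?_,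
    fun k => (hρ k).2.1, fun k => (hρ k).2.2.1, fun k => ?_, fun k z hz => ?_,
    fun k => (hρ k).2.2.2.2.2⟩, ?_⟩
  · rw [hs0]
    linarith [min_le_right (R / 4) (D / 2)]
  · intro k p x hpx
    refine (hc k x).trans (measureReal_le_kernelMass (hspos k)
      Metric.isOpen_ball.measurableSet fun y hy => ?_)
    have h1 : dist (y : X) x < s k / 2 := hy
    linarith [dist_triangle_right p y (x : X)]
  · exact squeeze_zero (fun k => (hρ k).1.le) (fun k => (hρ k).2.2.2.1)
      (tendsto_pow_atTop_nhds_zero_of_lt_one (by norm_num) (by norm_num))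
  · exact (hρ k).2.2.2.2.1.trans (mul_le_of_le_one_right zero_le (min_le_left _ _))
  · refine (hρ k).2.2.2.2.1.trans ?_
    gcongr
    exact (min_le_right _ _).trans (hb k z hz)
  · rw [hs0]
    linarith [min_le_left (R / 4) (D / 2)]

end Layering

/-! ### Estimates for the layered extension -/

lemma measurableSet_layer {X : Type*} [MetricSpace X] [MeasurableSpace X] [OpensMeasurableSpace X]
    {Ω : Set X} (r : ℝ) : MeasurableSet {p : Ω | Metric.infDist (p : X) (frontier Ω) < r} :=
  (isOpen_lt ((Metric.continuous_infDist_pt _).comp continuous_subtype_val)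
    continuous_const).measurableSet

lemma tsum_inv_two_pow : ∑' k : ℕ, (2⁻¹ : ℝ≥0∞) ^ k = 2 := by
  rw [ENNReal.tsum_geometric, ENNReal.one_sub_inv_two, inv_inv]

/-- A locally Lipschitz integrable function may be approximated by the constant sequence. -/
lemma totalVariation_le_lintegral {Y : Type*} [MetricSpace Y] [MeasurableSpace Y] {m : Measure Y}
    {u : Y → ℝ} {g : Y → ℝ≥0∞} (hu : LocallyLipschitz u) (hu1 : MemLp u 1 m)
    (hg : IsUpperGradient g u) : totalVariation m u ≤ ∫⁻ y, g y ∂m := by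
  refine (iInf_le _ (fun _ => u)).trans ((iInf_le _ fun _ => ⟨hu, hu1⟩).trans
    ((iInf_le _ (by simp)).trans ?_))
  rw [liminf_const]
  exact (iInf_le _ g).trans (iInf_le _ hg)

lemma totalVariation_congr_ae {Y : Type*} [MetricSpace Y] [MeasurableSpace Y] {m : Measure Y}
    {u v : Y → ℝ} (h : u =ᵐ[m] v) : totalVariation m u = totalVariation m v := by
  have : ∀ w : Y → ℝ, eLpNorm (w - u) 1 m = eLpNorm (w - v) 1 m := fun w =>
    eLpNorm_congr_ae ((EventuallyEq.refl _ w).sub h)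
  simp only [totalVariation, this]

section LayeredExtension

variable {X : Type*} [MetricSpace X] [MeasurableSpace X]

lemma layeredExtension_eq_sum {S : Set X} {ν : Measure S} {s c ρ : ℕ → ℝ} {f : S → ℝ} {p : X}
    {K : ℕ} (hρ : ∀ k, 0 < ρ k) (hK : ∀ k, K ≤ k → ρ k ≤ Metric.infDist p S) :
    layeredExtension ν s c ρ f p = ∑ k ∈ Finset.range K,
      cutoff (2 * Metric.infDist p S / ρ k) * smoothingDiff ν s c f k p := by
  refine tsum_eq_sum fun k hk => ?_
  rw [Finset.mem_range, not_lt] at hk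
  rw [cutoff_eq_zero, zero_mul]
  rw [le_div_iff₀ (hρ k)]
  linarith [hK k hk]

lemma layeredExtension_congr_ae {S : Set X} {ν : Measure S} {s c ρ : ℕ → ℝ} {f g : S → ℝ}
    (h : f =ᵐ[ν] g) : layeredExtension ν s c ρ f = layeredExtension ν s c ρ g := by
  have hseq : ∀ k, smoothingSeq ν s c f k = smoothingSeq ν s c g k := by
    rintro (_ | k)
    · rfl
    · exact smoothing_congr_ae h
  ext p
  simp only [layeredExtension, smoothingDiff, hseq]

variable [BorelSpace X] {μ : Measure X} {Ω : Set X} {A : ℝ≥0} {D : ℝ} {s c ρ : ℕ → ℝ}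
  {f g : frontier Ω → ℝ}

lemma IsLayering.exists_forall_thickness_le (L : IsLayering μ Ω D s c ρ) {δ : ℝ} (hδ : 0 < δ) :
    ∃ K, ∀ k, K ≤ k → ρ k ≤ δ :=
  eventually_atTop.1 (L.thickness_tendsto.eventually_le_const hδ)

/-- The cutoffs vanish once ρ k is below the depth of p. The bound K serves all f at once, as
linearity requires, and may be increased, so that two points can share it. -/
lemma IsLayering.exists_layeredExtension_eq_sum (L : IsLayering μ Ω D s c ρ) (hΩ : IsOpen Ω)
    (hne : (frontier Ω).Nonempty) (p : Ω) : ∃ K, ∀ f : frontier Ω → ℝ, ∀ K', K ≤ K' →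
      layeredExtension (boundaryMeasure μ Ω) s c ρ f (p : X) = ∑ k ∈ Finset.range K',
        cutoff (2 * Metric.infDist (p : X) (frontier Ω) / ρ k) *
          smoothingDiff (boundaryMeasure μ Ω) s c f k (p : X) := by
  obtain ⟨K, hK⟩ := L.exists_forall_thickness_le (infDist_frontier_pos hΩ hne p)
  exact ⟨K, fun f K' hK' => layeredExtension_eq_sum L.thickness_pos
    fun k hk => hK k (hK'.trans hk)⟩

lemma IsLayering.layeredExtension_add [IsFiniteMeasure (boundaryMeasure μ Ω)]
    (L : IsLayering μ Ω D s c ρ) (hΩ : IsOpen Ω) (hne : (frontier Ω).Nonempty)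
    (hf : Integrable f (boundaryMeasure μ Ω)) (hg : Integrable g (boundaryMeasure μ Ω)) (p : Ω) :
    layeredExtension (boundaryMeasure μ Ω) s c ρ (f + g) (p : X) =
      layeredExtension (boundaryMeasure μ Ω) s c ρ f (p : X) +
        layeredExtension (boundaryMeasure μ Ω) s c ρ g (p : X) := by
  obtain ⟨K, hK⟩ := L.exists_layeredExtension_eq_sum hΩ hne p
  rw [hK _ K le_rfl, hK _ K le_rfl, hK _ K le_rfl, ← Finset.sum_add_distrib]
  have hseq : ∀ k, smoothingSeq (boundaryMeasure μ Ω) s c (f + g) k (p : X) =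
      smoothingSeq (boundaryMeasure μ Ω) s c f k (p : X) +
        smoothingSeq (boundaryMeasure μ Ω) s c g k (p : X) := by
    rintro (_ | k)
    · simp [smoothingSeq]
    · exact smoothing_add hf hg _
  refine Finset.sum_congr rfl fun k _ => ?_
  rw [smoothingDiff, smoothingDiff, smoothingDiff, hseq, hseq]
  ring

lemma IsLayering.layeredExtension_smul (L : IsLayering μ Ω D s c ρ) (hΩ : IsOpen Ω)
    (hne : (frontier Ω).Nonempty) (a : ℝ) (p : Ω) :
    layeredExtension (boundaryMeasure μ Ω) s c ρ (a • f) (p : X) =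
      a * layeredExtension (boundaryMeasure μ Ω) s c ρ f (p : X) := by
  obtain ⟨K, hK⟩ := L.exists_layeredExtension_eq_sum hΩ hne p
  rw [hK _ K le_rfl, hK _ K le_rfl, Finset.mul_sum]
  have hseq : ∀ k, smoothingSeq (boundaryMeasure μ Ω) s c (a • f) k (p : X) =
      a * smoothingSeq (boundaryMeasure μ Ω) s c f k (p : X) := by
    rintro (_ | k)
    · simp [smoothingSeq]
    · exact smoothing_smul _ _
  refine Finset.sum_congr rfl fun k _ => ?_
  rw [smoothingDiff, smoothingDiff, hseq, hseq]
  ring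

omit [MeasurableSpace X] [BorelSpace X] in
lemma abs_cutoff_infDist_sub_le {S : Set X} {r : ℝ} (hr : 0 < r) (p q : X) :
    |cutoff (2 * Metric.infDist p S / r) - cutoff (2 * Metric.infDist q S / r)| ≤
      2 / r * dist p q := by
  refine (abs_cutoff_sub_le _ _).trans ?_
  rw [← sub_div, ← mul_sub, mul_div_right_comm, abs_mul, abs_of_pos (by positivity : 0 < 2 / r)]
  gcongr
  exact abs_sub_le_iff.2 ⟨by linarith [Metric.infDist_le_infDist_add_dist (s := S) (x := p) (y := q)],
    by linarith [Metric.infDist_le_infDist_add_dist (s := S) (x := q) (y := p), dist_comm p q]⟩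

section Estimates

variable (L : IsLayering μ Ω D s c ρ)
  (hf : Integrable f (boundaryMeasure μ Ω))
include hf

lemma ofReal_integral_abs_eq : ENNReal.ofReal (∫ y, |f y| ∂(boundaryMeasure μ Ω)) =
    eLpNorm f 1 (boundaryMeasure μ Ω) := by
  rw [eLpNorm_one_eq_lintegral_enorm, ← ofReal_integral_norm_eq_lintegral_enorm hf]
  rfl

include L

lemma IsLayering.enorm_smoothingDiff_le (k : ℕ) (p : X) :
    ‖smoothingDiff (boundaryMeasure μ Ω) s c f k p‖ₑ ≤
      ENNReal.ofReal (diffBound (boundaryMeasure μ Ω) s c k) *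
        eLpNorm f 1 (boundaryMeasure μ Ω) := by
  rw [← ofReal_integral_abs_eq hf, ← ENNReal.ofReal_mul (diffBound_nonneg L.scale_pos L.level_pos k),
    Real.enorm_eq_ofReal_abs]
  exact ENNReal.ofReal_le_ofReal (abs_smoothingDiff_le L.scale_pos L.level_pos hf k p)

/-- The k-th term is at most M_k ‖f‖_{L¹} and lives on a layer whose measure times M_k is at most
2^{-k}. -/
lemma IsLayering.eLpNorm_le (hΩ : IsOpen Ω) (hne : (frontier Ω).Nonempty) :
    eLpNorm (fun p : Ω => layeredExtension (boundaryMeasure μ Ω) s c ρ f (p : X)) 1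
      (domainMeasure μ Ω) ≤ 2 * eLpNorm f 1 (boundaryMeasure μ Ω) := by
  set N := eLpNorm f 1 (boundaryMeasure μ Ω) with hN
  set M := diffBound (boundaryMeasure μ Ω) s c with hM
  rw [eLpNorm_one_eq_lintegral_enorm]
  calc ∫⁻ p : Ω, ‖layeredExtension (boundaryMeasure μ Ω) s c ρ f (p : X)‖ₑ ∂(domainMeasure μ Ω)
      ≤ ∫⁻ p : Ω, ∑' k, {p : Ω | Metric.infDist (p : X) (frontier Ω) < 2 * ρ k}.indicator
          (fun _ => ENNReal.ofReal (M k) * N) p ∂(domainMeasure μ Ω) := by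
        refine lintegral_mono fun p => ?_
        obtain ⟨K, hK⟩ := L.exists_layeredExtension_eq_sum hΩ hne p
        rw [hK f K le_rfl]
        refine (enorm_sum_le _ _).trans ((Finset.sum_le_sum fun k _ => ?_).trans
          (ENNReal.sum_le_tsum (Finset.range K)))
        have hρ := L.thickness_pos k
        by_cases hp : Metric.infDist (p : X) (frontier Ω) < 2 * ρ k
        · rw [indicator_of_mem (by exact hp), enorm_mul]
          refine (mul_le_of_le_one_left zero_le ?_).trans (L.enorm_smoothingDiff_le hf k p)
          rw [Real.enorm_eq_ofReal (cutoff_nonneg _), ENNReal.ofReal_le_one]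
          exact cutoff_le_one _
        · rw [cutoff_eq_zero, zero_mul, enorm_zero]
          · exact zero_le
          · rw [le_div_iff₀ hρ]
            linarith [not_lt.1 hp]
    _ = ∑' k, ENNReal.ofReal (M k) * N *
          domainMeasure μ Ω {p : Ω | Metric.infDist (p : X) (frontier Ω) < 2 * ρ k} := by
        rw [lintegral_tsum fun k =>
          (measurable_const.indicator (measurableSet_layer _)).aemeasurable]
        simp_rw [lintegral_indicator_const (measurableSet_layer _)]
    _ ≤ ∑' k, 2⁻¹ ^ k * N := by
        refine ENNReal.tsum_le_tsum fun k => ?_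
        rw [mul_right_comm]
        gcongr
        exact L.layer_le k
    _ = 2 * N := by rw [ENNReal.tsum_mul_right, tsum_inv_two_pow]

variable [IsFiniteMeasure (boundaryMeasure μ Ω)]

/-- Product rule. The smoothing enters undifferentiated only at q, which becomes the base point of
the local slope. -/
lemma IsLayering.abs_term_sub_le (k : ℕ) (p q : X) :
    |cutoff (2 * Metric.infDist p (frontier Ω) / ρ k) *
        smoothingDiff (boundaryMeasure μ Ω) s c f k p -
      cutoff (2 * Metric.infDist q (frontier Ω) / ρ k) *
        smoothingDiff (boundaryMeasure μ Ω) s c f k q| ≤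
      (diffBound (boundaryMeasure μ Ω) s c k * (∫ y, |f y| ∂(boundaryMeasure μ Ω)) +
        2 / ρ k * |smoothingDiff (boundaryMeasure μ Ω) s c f k q|) * dist p q := by
  set a := cutoff (2 * Metric.infDist p (frontier Ω) / ρ k)
  set b := cutoff (2 * Metric.infDist q (frontier Ω) / ρ k)
  set x := smoothingDiff (boundaryMeasure μ Ω) s c f k p
  set y := smoothingDiff (boundaryMeasure μ Ω) s c f k q
  have h1 : |x - y| ≤ _ := abs_smoothingDiff_sub_le L.scale_pos L.level_pos hf k p q
  have h2 : |a - b| ≤ 2 / ρ k * dist p q := abs_cutoff_infDist_sub_le (L.thickness_pos k) p q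
  have ha : |a| ≤ 1 := by
    rw [abs_of_nonneg (cutoff_nonneg _)]
    exact cutoff_le_one _
  calc |a * x - b * y| = |a * (x - y) + (a - b) * y| := by ring_nf
    _ ≤ |a| * |x - y| + |a - b| * |y| := by
        rw [← abs_mul, ← abs_mul]
        exact abs_add_le _ _
    _ ≤ 1 * (diffBound (boundaryMeasure μ Ω) s c k * (∫ y, |f y| ∂(boundaryMeasure μ Ω)) *
          dist p q) + 2 / ρ k * dist p q * |y| := by gcongr
    _ = _ := by ring

lemma IsLayering.locallyLipschitz (hΩ : IsOpen Ω) (hne : (frontier Ω).Nonempty) :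
    LocallyLipschitz fun p : Ω =>
      layeredExtension (boundaryMeasure μ Ω) s c ρ f (p : X) := by
  intro p₀
  set d := Metric.infDist (p₀ : X) (frontier Ω) with hd
  have hdpos : 0 < d := infDist_frontier_pos hΩ hne p₀
  obtain ⟨K, hK⟩ := L.exists_forall_thickness_le (half_pos hdpos)
  set I := ∫ y, |f y| ∂(boundaryMeasure μ Ω) with hI
  have hI0 : 0 ≤ I := integral_nonneg fun _ => abs_nonneg _
  set M := diffBound (boundaryMeasure μ Ω) s c with hM
  have hM0 : ∀ k, 0 ≤ M k := diffBound_nonneg L.scale_pos L.level_pos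
  have hsum : ∀ p ∈ Metric.ball p₀ (d / 2),
      layeredExtension (boundaryMeasure μ Ω) s c ρ f (p : X) = ∑ k ∈ Finset.range K,
        cutoff (2 * Metric.infDist (p : X) (frontier Ω) / ρ k) *
          smoothingDiff (boundaryMeasure μ Ω) s c f k (p : X) := by
    intro p hp
    refine layeredExtension_eq_sum L.thickness_pos fun k hk => (hK k hk).trans ?_
    have h1 : dist (p : X) p₀ < d / 2 := hp
    have h2 := Metric.infDist_le_infDist_add_dist (s := frontier Ω) (x := (p₀ : X)) (y := p)
    rw [dist_comm] at h2
    linarith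
  refine ⟨(∑ k ∈ Finset.range K, (M k * I + 2 / ρ k * (M k * I))).toNNReal,
    Metric.ball p₀ (d / 2), Metric.ball_mem_nhds _ (half_pos hdpos), ?_⟩
  refine LipschitzOnWith.of_dist_le_mul fun p hp q hq => ?_
  have hρ := L.thickness_pos
  rw [Real.coe_toNNReal _ (Finset.sum_nonneg fun k _ => by
    have := hρ k
    have := hM0 k
    positivity), hsum p hp, hsum q hq, Real.dist_eq, ← Finset.sum_sub_distrib, Finset.sum_mul]
  refine (Finset.abs_sum_le_sum_abs _ _).trans (Finset.sum_le_sum fun k _ => ?_)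
  refine (L.abs_term_sub_le hf k (p : X) q).trans ?_
  have := hρ k
  have h3 := abs_smoothingDiff_le L.scale_pos L.level_pos hf k (q : X)
  rw [Subtype.dist_eq]
  gcongr

/-- The upper gradient of the `k`-th term of the layered extension. -/
lemma IsLayering.isUpperGradient_term (k : ℕ) :
    IsUpperGradient (fun p : Ω => ENNReal.ofReal
      (cutoff (Metric.infDist (p : X) (frontier Ω) / ρ k) *
        (diffBound (boundaryMeasure μ Ω) s c k * (∫ y, |f y| ∂(boundaryMeasure μ Ω)) +
          2 / ρ k * |smoothingDiff (boundaryMeasure μ Ω) s c f k (p : X)|)))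
      (fun p : Ω => cutoff (2 * Metric.infDist (p : X) (frontier Ω) / ρ k) *
        smoothingDiff (boundaryMeasure μ Ω) s c f k (p : X)) := by
  have hρ := L.thickness_pos k
  have hM0 := diffBound_nonneg (ν := boundaryMeasure μ Ω) L.scale_pos L.level_pos k
  have hI0 : 0 ≤ ∫ y, |f y| ∂(boundaryMeasure μ Ω) := integral_nonneg fun _ => abs_nonneg _
  have hcontd : Continuous fun p : Ω => Metric.infDist (p : X) (frontier Ω) :=
    (Metric.continuous_infDist_pt _).comp continuous_subtype_val
  have hcontG : Continuous fun p : Ω => smoothingDiff (boundaryMeasure μ Ω) s c f k (p : X) := by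
    refine Continuous.comp (g := smoothingDiff (boundaryMeasure μ Ω) s c f k)
      ((LipschitzWith.of_dist_le_mul (K := (diffBound (boundaryMeasure μ Ω) s c k *
        (∫ y, |f y| ∂(boundaryMeasure μ Ω))).toNNReal) fun p q => ?_).continuous)
      continuous_subtype_val
    rw [Real.coe_toNNReal _ (by positivity), Real.dist_eq]
    exact abs_smoothingDiff_sub_le L.scale_pos L.level_pos hf k p q
  refine isUpperGradient_of_local_slope_le ?_ ?_ ?_
  · have h1 : Continuous fun p : Ω => cutoff (Metric.infDist (p : X) (frontier Ω) / ρ k) :=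
      continuous_cutoff.comp (hcontd.div_const (ρ k))
    exact h1.mul (continuous_const.add (continuous_const.mul hcontG.abs))
  · intro p
    have := cutoff_nonneg (Metric.infDist (p : X) (frontier Ω) / ρ k)
    positivity
  · intro p ε hε
    rcases le_or_gt (Metric.infDist (p : X) (frontier Ω)) (ρ k) with hp | hp
    · refine Eventually.of_forall fun q => ?_
      rw [cutoff_eq_one ((div_le_one hρ).2 hp), one_mul]
      refine (L.abs_term_sub_le hf k (q : X) p).trans ?_
      rw [Subtype.dist_eq]
      exact mul_le_mul_of_nonneg_right (le_add_of_nonneg_right hε.le) dist_nonneg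
    · have hzero : ∀ q : Ω, ρ k < Metric.infDist (q : X) (frontier Ω) →
          cutoff (2 * Metric.infDist (q : X) (frontier Ω) / ρ k) = 0 := by
        intro q hq
        refine cutoff_eq_zero ?_
        rw [le_div_iff₀ hρ]
        linarith
      filter_upwards [hcontd.continuousAt.eventually (lt_mem_nhds hp)] with q hq
      rw [hzero q hq, hzero p hp, zero_mul, zero_mul, sub_zero, abs_zero]
      have := cutoff_nonneg (Metric.infDist (p : X) (frontier Ω) / ρ k)
      positivity

end Estimates

lemma IsLayering.lintegral_upperGradient_term_le (h : BoundaryEstimates μ Ω A D)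
    (L : IsLayering μ Ω D s c ρ) (hf : Integrable f (boundaryMeasure μ Ω)) (k : ℕ) :
    ∫⁻ p : Ω, ENNReal.ofReal (cutoff (Metric.infDist (p : X) (frontier Ω) / ρ k) *
        (diffBound (boundaryMeasure μ Ω) s c k * (∫ y, |f y| ∂(boundaryMeasure μ Ω)) +
          2 / ρ k * |smoothingDiff (boundaryMeasure μ Ω) s c f k (p : X)|))
        ∂(domainMeasure μ Ω) ≤
      (1 + 16 * A) * eLpNorm f 1 (boundaryMeasure μ Ω) * 2⁻¹ ^ k +
        4 * A * ∫⁻ z : frontier Ω, ‖smoothingDiff (boundaryMeasure μ Ω) s c f k (z : X)‖ₑ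
          ∂(boundaryMeasure μ Ω) := by
  have := h.isFinite_boundary
  set ν := boundaryMeasure μ Ω with hν
  set m := domainMeasure μ Ω with hm
  set N := eLpNorm f 1 ν with hN
  set M := diffBound ν s c with hM
  set I := ∫ y, |f y| ∂ν with hI
  set G := smoothingDiff ν s c f k with hG
  have hρ := L.thickness_pos k
  have hM0 : 0 ≤ M k := diffBound_nonneg L.scale_pos L.level_pos k
  have hI0 : 0 ≤ I := integral_nonneg fun _ => abs_nonneg _
  have hIN : ENNReal.ofReal I = N := ofReal_integral_abs_eq hf
  set B : Set Ω := {p : Ω | Metric.infDist (p : X) (frontier Ω) < 2 * ρ k} with hB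
  have hBm : MeasurableSet B := measurableSet_layer _
  have hGm : Measurable fun p : X => ‖G p‖ₑ := by
    have : Continuous G := by
      refine (LipschitzWith.of_dist_le_mul (K := (M k * I).toNNReal) fun p q => ?_).continuous
      rw [Real.coe_toNNReal _ (by positivity), Real.dist_eq]
      exact abs_smoothingDiff_sub_le L.scale_pos L.level_pos hf k p q
    exact this.measurable.enorm
  have hGc : ∀ (p : Ω) (z : frontier Ω), dist (p : X) z < 2 * (2 * ρ k) →
      ‖G p‖ₑ ≤ ‖G z‖ₑ + 4 * (ENNReal.ofReal (M k * ρ k) * N) := by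
    intro p z hpz
    have h1 : ‖G p‖ₑ ≤ ‖G z‖ₑ + ‖G p - G z‖ₑ := by
      simpa using enorm_add_le (G z) (G p - G z)
    refine h1.trans (add_le_add le_rfl ?_)
    rw [Real.enorm_eq_ofReal_abs, ← hIN, ← ENNReal.ofReal_mul (by positivity),
      ← ENNReal.ofReal_ofNat 4, ← ENNReal.ofReal_mul (by norm_num)]
    refine ENNReal.ofReal_le_ofReal
      ((abs_smoothingDiff_sub_le L.scale_pos L.level_pos hf k (p : X) z).trans ?_)
    calc M k * I * dist (p : X) z ≤ M k * I * (2 * (2 * ρ k)) := by gcongr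
      _ = 4 * (M k * ρ k * I) := by ring
  have hlayer := h.layer (2 * ρ k) (by positivity) (L.thickness_le k) (fun p => ‖G p‖ₑ) _ hGm hGc
  have hcoef : ENNReal.ofReal (2 / ρ k) * (A * ENNReal.ofReal (2 * ρ k)) = 4 * A := by
    rw [mul_left_comm, ← ENNReal.ofReal_mul (by positivity), mul_comm]
    congr 1
    rw [show 2 / ρ k * (2 * ρ k) = 4 by field_simp; norm_num]
    exact ENNReal.ofReal_ofNat 4
  calc ∫⁻ p : Ω, ENNReal.ofReal (cutoff (Metric.infDist (p : X) (frontier Ω) / ρ k) *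
        (M k * I + 2 / ρ k * |G p|)) ∂m
      ≤ ∫⁻ p in B, (ENNReal.ofReal (M k) * N + ENNReal.ofReal (2 / ρ k) * ‖G p‖ₑ) ∂m := by
        rw [← lintegral_indicator hBm]
        refine lintegral_mono fun p => ?_
        by_cases hp : p ∈ B
        · rw [indicator_of_mem hp, Real.enorm_eq_ofReal_abs, ← hIN, ← ENNReal.ofReal_mul hM0,
            ← ENNReal.ofReal_mul (by positivity), ← ENNReal.ofReal_add (by positivity)
            (by positivity)]
          exact ENNReal.ofReal_le_ofReal
            (mul_le_of_le_one_left (by positivity) (cutoff_le_one _))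
        · have hp' : ¬ Metric.infDist (p : X) (frontier Ω) < 2 * ρ k := hp
          rw [cutoff_eq_zero, zero_mul, ENNReal.ofReal_zero]
          · exact zero_le
          · rw [le_div_iff₀ hρ]
            exact not_lt.1 hp'
    _ = ENNReal.ofReal (M k) * N * m B + ENNReal.ofReal (2 / ρ k) * ∫⁻ p in B, ‖G p‖ₑ ∂m := by
        rw [lintegral_add_left measurable_const, setLIntegral_const,
          lintegral_const_mul' _ _ ENNReal.ofReal_ne_top]
    _ ≤ ENNReal.ofReal (M k) * N * m B + ENNReal.ofReal (2 / ρ k) *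
          (A * ENNReal.ofReal (2 * ρ k) *
            ∫⁻ z : frontier Ω, (‖G z‖ₑ + 4 * (ENNReal.ofReal (M k * ρ k) * N)) ∂ν) := by
        gcongr
    _ = ENNReal.ofReal (M k) * m B * N + 4 * A * (∫⁻ z : frontier Ω, ‖G z‖ₑ ∂ν +
          4 * (ENNReal.ofReal (M k * ρ k) * ν univ * N)) := by
        rw [← mul_assoc (ENNReal.ofReal (2 / ρ k)), hcoef, lintegral_add_right _ measurable_const,
          lintegral_const]
        ring
    _ ≤ 2⁻¹ ^ k * N + 4 * A * (∫⁻ z : frontier Ω, ‖G z‖ₑ ∂ν + 4 * (2⁻¹ ^ k * N)) := by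
        have h1 := L.layer_le k
        have h2 := L.mul_thickness_le k
        gcongr
    _ = _ := by ring

lemma IsLayering.tsum_lintegral_smoothingDiff_le (h : BoundaryEstimates μ Ω A D)
    (L : IsLayering μ Ω D s c ρ) (hfm : Measurable f) (hf : Integrable f (boundaryMeasure μ Ω))
    {R : ℝ} (hR : 4 * s 0 ≤ R) :
    ∑' k, ∫⁻ z : frontier Ω, ‖smoothingDiff (boundaryMeasure μ Ω) s c f k (z : X)‖ₑ
        ∂(boundaryMeasure μ Ω) ≤
      eLpNorm f 1 (boundaryMeasure μ Ω) +
        4 * A ^ 2 * besovEnergy (boundaryMeasure μ Ω) 0 R f := by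
  have := h.isFinite_boundary
  have hs := L.scale_pos
  have hsk : ∀ k, s k ≤ s 0 := fun k => by
    rw [L.scale_eq]
    exact div_le_self (hs 0).le (one_le_pow₀ one_le_two)
  set ν := boundaryMeasure μ Ω with hν
  set N := eLpNorm f 1 ν with hN
  set e : ℕ → ℝ≥0∞ := fun k => ∫⁻ z : frontier Ω, ‖smoothingSeq ν s c f k (z : X) - f z‖ₑ ∂ν
    with he
  have he0 : e 0 = N := by
    simp only [he, smoothingSeq, Pi.zero_apply, zero_sub, enorm_neg]
    rw [hN, eLpNorm_one_eq_lintegral_enorm]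
  have hesucc : ∀ k, e (k + 1) ≤ A * meanOscillation ν f (2 * s 0 / 2 ^ k) := by
    intro k
    have h1 : 2 * s 0 / 2 ^ k = 2 * s k := by rw [L.scale_eq k]; ring
    rw [h1]
    have hD := L.scale_le
    refine lintegral_smoothing_sub_le (hs k) hf (fun x => h.ball_pos x _ (hs k))
      (fun x => h.doubling x _ (hs k) (by linarith [hsk k, hs 0])) fun x => ?_
    exact L.level_le k x x (by rw [dist_self]; linarith [hs k])
  have hsum : ∑' k, e (k + 1) ≤ 2 * A ^ 2 * besovEnergy ν 0 R f := by
    calc ∑' k, e (k + 1) ≤ ∑' k : ℕ, A * meanOscillation ν f (2 * s 0 / 2 ^ k) :=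
          ENNReal.tsum_le_tsum hesucc
      _ = A * ∑' k : ℕ, meanOscillation ν f (2 * s 0 / 2 ^ k) := ENNReal.tsum_mul_left
      _ ≤ A * (2 * A * besovEnergy ν 0 R f) := by
          gcongr
          exact tsum_meanOscillation_le h.doubling h.ball_pos (by linarith [hs 0]) L.scale_le
            (by linarith)
      _ = _ := by ring
  have hmeas : ∀ k, Measurable fun z : frontier Ω => ‖smoothingSeq ν s c f k (z : X) - f z‖ₑ := by
    intro k
    refine Measurable.enorm (Measurable.sub ?_ hfm)
    cases k with
    | zero => exact measurable_const
    | succ k =>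
      refine Continuous.measurable (Continuous.comp (g := smoothing ν (s k) (c k) f) ?_
        continuous_subtype_val)
      refine (LipschitzWith.of_dist_le_mul (K := (smoothingBound ν (s k) (c k) *
        ∫ y, |f y| ∂ν).toNNReal) fun p q => ?_).continuous
      have hI0 : 0 ≤ ∫ y, |f y| ∂ν := integral_nonneg fun _ => abs_nonneg _
      have hb0 := smoothingBound_nonneg (ν := ν) hs L.level_pos k
      rw [Real.coe_toNNReal _ (by positivity), Real.dist_eq]
      exact abs_smoothing_sub_le_smoothingBound hs L.level_pos hf k p q
  have hterm : ∀ k, ∫⁻ z : frontier Ω, ‖smoothingDiff ν s c f k (z : X)‖ₑ ∂ν ≤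
      e (k + 1) + e k := by
    intro k
    simp only [he]
    rw [← lintegral_add_left (hmeas (k + 1))]
    refine lintegral_mono fun z => ?_
    have h1 : smoothingDiff ν s c f k (z : X) = (smoothingSeq ν s c f (k + 1) (z : X) - f z) -
        (smoothingSeq ν s c f k (z : X) - f z) := by rw [smoothingDiff]; ring
    rw [h1]
    exact enorm_sub_le
  calc ∑' k, ∫⁻ z : frontier Ω, ‖smoothingDiff ν s c f k (z : X)‖ₑ ∂ν
      ≤ ∑' k, (e (k + 1) + e k) := ENNReal.tsum_le_tsum hterm
    _ = ∑' k, e (k + 1) + (e 0 + ∑' k, e (k + 1)) := by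
        rw [ENNReal.tsum_add, ← tsum_eq_zero_add' ENNReal.summable]
    _ ≤ 2 * A ^ 2 * besovEnergy ν 0 R f + (N + 2 * A ^ 2 * besovEnergy ν 0 R f) := by
        rw [he0]
        gcongr
    _ = _ := by ring

lemma IsLayering.memLp (h : BoundaryEstimates μ Ω A D) (L : IsLayering μ Ω D s c ρ)
    (hΩ : IsOpen Ω) (hf : Integrable f (boundaryMeasure μ Ω)) :
    MemLp (fun p : Ω => layeredExtension (boundaryMeasure μ Ω) s c ρ f (p : X)) 1
      (domainMeasure μ Ω) := by
  have := h.isFinite_boundary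
  have := h.secondCountable
  refine ⟨(L.locallyLipschitz hf hΩ h.nonempty).continuous.aestronglyMeasurable,
    (L.eLpNorm_le hf hΩ h.nonempty).trans_lt ?_⟩
  exact ENNReal.mul_lt_top ENNReal.ofNat_lt_top (memLp_one_iff_integrable.2 hf).2

/-- The layered extension is bounded from `B^0_{1,1}` of the boundary to `BV`. -/
lemma IsLayering.bvNorm_le (h : BoundaryEstimates μ Ω A D) (L : IsLayering μ Ω D s c ρ)
    (hΩ : IsOpen Ω) (hfm : Measurable f) (hf : Integrable f (boundaryMeasure μ Ω))
    {R : ℝ} (hR : 4 * s 0 ≤ R) :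
    bvNorm (domainMeasure μ Ω)
        (fun p : Ω => layeredExtension (boundaryMeasure μ Ω) s c ρ f (p : X)) ≤
      ((4 + 36 * A + 16 * A ^ 3 : ℝ≥0) : ℝ≥0∞) * besovNorm (boundaryMeasure μ Ω) 0 R f := by
  have := h.isFinite_boundary
  have := h.secondCountable
  set N := eLpNorm f 1 (boundaryMeasure μ Ω) with hN
  have hTV : totalVariation (domainMeasure μ Ω)
      (fun p : Ω => layeredExtension (boundaryMeasure μ Ω) s c ρ f (p : X)) ≤
      (2 + 36 * A) * N + 16 * A ^ 3 * besovEnergy (boundaryMeasure μ Ω) 0 R f := by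
    refine (totalVariation_le_lintegral (L.locallyLipschitz hf hΩ h.nonempty)
      (L.memLp h hΩ hf) (IsUpperGradient.tsum (L.isUpperGradient_term hf) ?_)).trans ?_
    · intro p q
      obtain ⟨K₁, hK₁⟩ := L.exists_layeredExtension_eq_sum hΩ h.nonempty p
      obtain ⟨K₂, hK₂⟩ := L.exists_layeredExtension_eq_sum hΩ h.nonempty q
      exact ⟨max K₁ K₂, hK₁ f _ (le_max_left _ _), hK₂ f _ (le_max_right _ _)⟩
    · rw [lintegral_tsum fun k => (L.isUpperGradient_term hf k).1.aemeasurable]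
      refine (ENNReal.tsum_le_tsum (L.lintegral_upperGradient_term_le h hf)).trans ?_
      rw [ENNReal.tsum_add, ENNReal.tsum_mul_left, ENNReal.tsum_mul_left, tsum_inv_two_pow]
      refine (add_le_add le_rfl (mul_le_mul_right
        (L.tsum_lintegral_smoothingDiff_le h hfm hf hR) _)).trans (le_of_eq ?_)
      ring
  have hL1 := L.eLpNorm_le hf hΩ h.nonempty
  rw [bvNorm, besovNorm]
  refine (add_le_add hL1 hTV).trans ?_
  push_cast
  calc 2 * N + ((2 + 36 * A) * N + 16 * A ^ 3 * besovEnergy (boundaryMeasure μ Ω) 0 R f)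
      = (4 + 36 * A) * N + 16 * A ^ 3 * besovEnergy (boundaryMeasure μ Ω) 0 R f := by ring
    _ ≤ (4 + 36 * A + 16 * A ^ 3) * N +
          (4 + 36 * A + 16 * A ^ 3) * besovEnergy (boundaryMeasure μ Ω) 0 R f := by
        exact add_le_add (mul_le_mul_left le_self_add _) (mul_le_mul_left le_add_self _)
    _ = _ := by ring

end LayeredExtension

/-! ### The trace of the layered extension -/

section Trace

variable {X : Type*} [MetricSpace X] [MeasurableSpace X] [BorelSpace X] {μ : Measure X} {Ω : Set X}
  {A : ℝ≥0} {D : ℝ} {s c ρ : ℕ → ℝ} {f : frontier Ω → ℝ}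

lemma BoundaryEstimates.isUnifLocDoublingMeasure (h : BoundaryEstimates μ Ω A D) :
    IsUnifLocDoublingMeasure (boundaryMeasure μ Ω) := by
  refine ⟨A ^ 2, ?_⟩
  have hD := h.pos
  filter_upwards [Ioc_mem_nhdsGT (half_pos hD)] with r hr x
  calc boundaryMeasure μ Ω (Metric.closedBall x (2 * r))
      ≤ boundaryMeasure μ Ω (Metric.ball x (2 * (2 * r))) :=
        measure_mono (Metric.closedBall_subset_ball (by linarith [hr.1]))
    _ ≤ A * (A * boundaryMeasure μ Ω (Metric.ball x r)) :=
        (h.doubling x _ (by linarith [hr.1]) (by linarith [hr.2])).trans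
          (mul_le_mul_right (h.doubling x r hr.1 (by linarith [hr.2])) _)
    _ ≤ A * (A * boundaryMeasure μ Ω (Metric.closedBall x r)) := by
        gcongr
        exact Metric.ball_subset_closedBall
    _ = _ := by push_cast; ring

lemma BoundaryEstimates.ae_lebesgue_point (h : BoundaryEstimates μ Ω A D)
    (hf : Integrable f (boundaryMeasure μ Ω)) :
    ∀ᵐ z ∂(boundaryMeasure μ Ω), ∀ ε : ℝ≥0∞, 0 < ε → ∃ δ > 0, ∀ r, 0 < r → r < δ →
      ∫⁻ y in Metric.ball z r, ‖f y - f z‖ₑ ∂(boundaryMeasure μ Ω) ≤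
        ε * boundaryMeasure μ Ω (Metric.ball z r) := by
  have := h.isFinite_boundary
  have := h.secondCountable
  have := h.isUnifLocDoublingMeasure
  set ν := boundaryMeasure μ Ω
  filter_upwards [IsUnifLocDoublingMeasure.ae_tendsto_average_norm_sub ν hf.locallyIntegrable 1]
    with z hz ε hε
  have h1 := hz (l := 𝓝[>] (0 : ℝ)) (fun _ => z) id tendsto_id
    (by filter_upwards [self_mem_nhdsWithin] with r hr
        exact Metric.mem_closedBall_self (by simpa using (le_of_lt hr)))
  have h2 : Tendsto (fun r : ℝ => ENNReal.ofReal (⨍ y in Metric.closedBall z r, ‖f y - f z‖ ∂ν))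
      (𝓝[>] 0) (𝓝 0) := by
    simpa using ENNReal.tendsto_ofReal h1
  have hA : (A : ℝ≥0∞) ≠ 0 := by exact_mod_cast (zero_lt_one.trans_le h.one_le).ne'
  have h3 := (h2.eventually_le_const (ENNReal.div_pos hε.ne' (ENNReal.coe_ne_top (r := A)))).and
    (Ioc_mem_nhdsGT h.pos)
  obtain ⟨δ, hδ, hδ'⟩ := mem_nhdsGT_iff_exists_Ioo_subset.1 h3
  refine ⟨δ, hδ, fun r hr hrδ => ?_⟩
  obtain ⟨h4, h5⟩ := hδ' ⟨hr, hrδ⟩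
  calc ∫⁻ y in Metric.ball z r, ‖f y - f z‖ₑ ∂ν
      ≤ ∫⁻ y in Metric.closedBall z r, ‖f y - f z‖ₑ ∂ν :=
        lintegral_mono_set Metric.ball_subset_closedBall
    _ = ENNReal.ofReal (∫ y in Metric.closedBall z r, ‖f y - f z‖ ∂ν) := by
        rw [ofReal_integral_norm_eq_lintegral_enorm]
        exact (hf.sub (integrable_const _)).integrableOn
    _ = ν (Metric.closedBall z r) *
          ENNReal.ofReal (⨍ y in Metric.closedBall z r, ‖f y - f z‖ ∂ν) := by
        rw [← measure_smul_setAverage _ (measure_ne_top _ _), smul_eq_mul,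
          ENNReal.ofReal_mul measureReal_nonneg, ofReal_measureReal]
    _ ≤ ν (Metric.ball z (2 * r)) * (ε / A) := by
        gcongr
        exact Metric.closedBall_subset_ball (by linarith)
    _ ≤ A * ν (Metric.ball z r) * (ε / A) := by
        gcongr
        exact h.doubling z r hr h5.2
    _ = ε / A * A * ν (Metric.ball z r) := by ring
    _ = ε * ν (Metric.ball z r) := by rw [ENNReal.div_mul_cancel hA ENNReal.coe_ne_top]

/-- Close to the boundary, the layered extension is a convex combination of smoothings. -/
lemma IsLayering.exists_weights (L : IsLayering μ Ω D s c ρ) (hΩ : IsOpen Ω)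
    (hne : (frontier Ω).Nonempty) (p : Ω)
    (hp : 2 * Metric.infDist (p : X) (frontier Ω) ≤ ρ 0) (a : ℝ) :
    ∃ (K : ℕ) (w : ℕ → ℝ≥0∞), ∑ k ∈ Finset.range K, w k = 1 ∧
      (∀ k, w k ≠ 0 → Metric.infDist (p : X) (frontier Ω) < ρ k ∧
        ρ (k + 1) < 2 * Metric.infDist (p : X) (frontier Ω)) ∧
      ‖layeredExtension (boundaryMeasure μ Ω) s c ρ f (p : X) - a‖ₑ ≤
        ∑ k ∈ Finset.range K, w k * ‖smoothing (boundaryMeasure μ Ω) (s k) (c k) f (p : X) - a‖ₑ := by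
  obtain ⟨K, hK⟩ := L.exists_forall_thickness_le (infDist_frontier_pos hΩ hne p)
  set ν := boundaryMeasure μ Ω
  set d := Metric.infDist (p : X) (frontier Ω) with hd
  have hρ := L.thickness_pos
  set η : ℕ → ℝ := fun k => cutoff (2 * d / ρ k) with hη
  have hd0 : 0 ≤ d := Metric.infDist_nonneg
  have hanti : ∀ k, η (k + 1) ≤ η k := fun k => by
    refine cutoff_antitone ?_
    have := hρ (k + 1)
    have := L.thickness_antitone k.le_succ
    gcongr
  have hη0 : η 0 = 1 := cutoff_eq_one ((div_le_one (hρ 0)).2 hp)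
  have hηK : η K = 0 := by
    refine cutoff_eq_zero ?_
    rw [le_div_iff₀ (hρ K)]
    linarith [hK K le_rfl]
  have habel : ∀ n, ∑ k ∈ Finset.range n, η k * smoothingDiff ν s c f k (p : X) =
      ∑ k ∈ Finset.range n, (η k - η (k + 1)) * smoothing ν (s k) (c k) f (p : X) +
        η n * smoothingSeq ν s c f n (p : X) := by
    intro n
    induction n with
    | zero => simp [smoothingSeq]
    | succ n ih =>
      rw [Finset.sum_range_succ, Finset.sum_range_succ, ih, smoothingDiff]
      simp only [smoothingSeq]
      ring
  have hone : ∑ k ∈ Finset.range K, (η k - η (k + 1)) = 1 := by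
    rw [Finset.sum_range_sub', hη0, hηK, sub_zero]
  refine ⟨K, fun k => ENNReal.ofReal (η k - η (k + 1)), ?_, fun k hk => ?_, ?_⟩
  · rw [← ENNReal.ofReal_sum_of_nonneg fun k _ => sub_nonneg.2 (hanti k), hone, ENNReal.ofReal_one]
  · rw [Ne, ENNReal.ofReal_eq_zero, not_le, sub_pos] at hk
    constructor
    · by_contra! hcon
      have : η k = 0 := by
        refine cutoff_eq_zero ?_
        rw [le_div_iff₀ (hρ k)]
        linarith
      linarith [cutoff_nonneg (2 * d / ρ (k + 1))]
    · by_contra! hcon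
      have : η (k + 1) = 1 := cutoff_eq_one ((div_le_one (hρ _)).2 hcon)
      linarith [cutoff_le_one (2 * d / ρ k)]
  · have heq : layeredExtension ν s c ρ f (p : X) - a = ∑ k ∈ Finset.range K,
        (η k - η (k + 1)) * (smoothing ν (s k) (c k) f (p : X) - a) := by
      have h0 : layeredExtension ν s c ρ f (p : X) =
          ∑ k ∈ Finset.range K, η k * smoothingDiff ν s c f k (p : X) :=
        layeredExtension_eq_sum hρ hK
      rw [h0, habel K, hηK, zero_mul, add_zero]
      simp only [mul_sub]
      rw [Finset.sum_sub_distrib, ← Finset.sum_mul, hone, one_mul]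
    rw [heq]
    refine (enorm_sum_le _ _).trans (le_of_eq (Finset.sum_congr rfl fun k _ => ?_))
    rw [enorm_mul, Real.enorm_eq_ofReal (sub_nonneg.2 (hanti k))]

/-- The deviation of a smoothing from the value at a Lebesgue point, at points whose distance to
the Lebesgue point is at most half the scale of the smoothing. -/
lemma IsLayering.enorm_smoothing_sub_le_of_le (h : BoundaryEstimates μ Ω A D)
    (L : IsLayering μ Ω D s c ρ) (hf : Integrable f (boundaryMeasure μ Ω)) {z : frontier Ω}
    {ε : ℝ≥0∞} {k : ℕ} {p : X} (hpz : dist p z ≤ s k / 2)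
    (hε : ∫⁻ y in Metric.ball z (4 * s k), ‖f y - f z‖ₑ ∂(boundaryMeasure μ Ω) ≤
      ε * boundaryMeasure μ Ω (Metric.ball z (4 * s k))) :
    ‖smoothing (boundaryMeasure μ Ω) (s k) (c k) f p - f z‖ₑ ≤ A ^ 3 * ε := by
  have := h.isFinite_boundary
  set ν := boundaryMeasure μ Ω
  have hs := L.scale_pos k
  have hs0 := L.scale_pos 0
  have hsD : 2 * s k ≤ D := by
    have : s k ≤ s 0 := by
      rw [L.scale_eq k]
      exact div_le_self hs0.le (one_le_pow₀ one_le_two)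
    linarith [L.scale_le]
  have hB0 : ν (Metric.ball z (s k / 2)) ≠ 0 := (h.ball_pos z _ (half_pos hs)).ne'
  have h1 := enorm_smoothing_sub_le_laverage hs hf (L.level_le k p z hpz)
    (B := Metric.ball z (s k / 2)) Metric.isOpen_ball.measurableSet (fun y hy => by
      have hy' : dist (y : X) z < s k / 2 := hy
      linarith [dist_triangle_right p (y : X) z]) hB0 (f z)
  have hsub : {y : frontier Ω | dist p y < 2 * s k} ⊆ Metric.ball z (4 * s k) := by
    intro y hy
    rw [mem_ofPred_eq] at hy
    change dist (y : X) z < 4 * s k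
    linarith [dist_triangle_left (y : X) z p]
  have hdoub : ν (Metric.ball z (4 * s k)) ≤ A ^ 3 * ν (Metric.ball z (s k / 2)) := by
    calc ν (Metric.ball z (4 * s k)) = ν (Metric.ball z (2 * (2 * (2 * (s k / 2))))) := by ring_nf
      _ ≤ A * (A * (A * ν (Metric.ball z (s k / 2)))) := by
          refine (h.doubling z _ (by positivity) (by linarith)).trans (mul_le_mul_right ?_ _)
          refine (h.doubling z _ (by positivity) (by linarith)).trans (mul_le_mul_right ?_ _)
          exact h.doubling z _ (by positivity) (by linarith)
      _ = _ := by ring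
  calc ‖smoothing ν (s k) (c k) f p - f z‖ₑ
      ≤ (ν (Metric.ball z (s k / 2)))⁻¹ *
          ∫⁻ y in {y : frontier Ω | dist p y < 2 * s k}, ‖f y - f z‖ₑ ∂ν := h1
    _ ≤ (ν (Metric.ball z (s k / 2)))⁻¹ * (ε * (A ^ 3 * ν (Metric.ball z (s k / 2)))) := by
        gcongr
        exact (lintegral_mono_set hsub).trans (hε.trans (mul_le_mul_right hdoub _))
    _ = A ^ 3 * ε * ((ν (Metric.ball z (s k / 2)))⁻¹ * ν (Metric.ball z (s k / 2))) := by ring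
    _ = A ^ 3 * ε := by rw [ENNReal.inv_mul_cancel hB0 (measure_ne_top _ _), mul_one]

/-- The deviation of a smoothing at a scale smaller than the distance to the Lebesgue point. -/
lemma IsLayering.enorm_smoothing_sub_le_of_lt (h : BoundaryEstimates μ Ω A D)
    (L : IsLayering μ Ω D s c ρ) (hf : Integrable f (boundaryMeasure μ Ω)) {z : frontier Ω}
    {ε : ℝ≥0∞} {k : ℕ} {p : X} {r : ℝ} (hpz : dist p z < r) (hr : s k < 2 * r)
    (hp : Metric.infDist p (frontier Ω) < ρ k)
    (hε : ∫⁻ y in Metric.ball z (5 * r), ‖f y - f z‖ₑ ∂(boundaryMeasure μ Ω) ≤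
      ε * boundaryMeasure μ Ω (Metric.ball z (5 * r))) :
    ‖smoothing (boundaryMeasure μ Ω) (s k) (c k) f p - f z‖ₑ ≤
      ENNReal.ofReal (diffBound (boundaryMeasure μ Ω) s c k) *
        (ε * boundaryMeasure μ Ω univ) := by
  have := h.isFinite_boundary
  set ν := boundaryMeasure μ Ω
  obtain ⟨x, hx, hpx⟩ := (Metric.infDist_lt_iff h.nonempty).1 hp
  have hcN := L.level_le k p ⟨x, hx⟩ (by simp only; linarith [L.thickness_le_scale k])
  have hc := L.level_pos k
  have hsub : {y : frontier Ω | dist p y < 2 * s k} ⊆ Metric.ball z (5 * r) := by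
    intro y hy
    rw [mem_ofPred_eq] at hy
    change dist (y : X) z < 5 * r
    linarith [dist_triangle_left (y : X) z p]
  refine (enorm_smoothing_sub_le (L.scale_pos k) hf hc hcN hcN (f z)).trans ?_
  rw [← ENNReal.ofReal_inv_of_pos hc]
  refine mul_le_mul' (ENNReal.ofReal_le_ofReal (inv_le_diffBound L.scale_pos L.level_pos k)) ?_
  refine (lintegral_mono_set hsub).trans (hε.trans ?_)
  gcongr
  exact subset_univ _

/-- The trace of the layered extension of `f` at a Lebesgue point `z` of `f` is `f z`. -/
lemma IsLayering.hasTraceAt (h : BoundaryEstimates μ Ω A D) (L : IsLayering μ Ω D s c ρ)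
    (hΩ : IsOpen Ω) (hf : Integrable f (boundaryMeasure μ Ω)) {z : frontier Ω}
    (hz : ∀ ε : ℝ≥0∞, 0 < ε → ∃ δ > 0, ∀ r, 0 < r → r < δ →
      ∫⁻ y in Metric.ball z r, ‖f y - f z‖ₑ ∂(boundaryMeasure μ Ω) ≤
        ε * boundaryMeasure μ Ω (Metric.ball z r)) :
    HasTraceAt μ Ω (fun p : Ω => layeredExtension (boundaryMeasure μ Ω) s c ρ f (p : X))
      (z : X) (f z) := by
  have := h.isFinite_boundary
  have := h.isFinite_domain
  set ν := boundaryMeasure μ Ω with hν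
  set m := domainMeasure μ Ω with hm
  set M := diffBound ν s c with hM
  rw [HasTraceAt, ENNReal.tendsto_nhds_zero]
  intro ε₀ hε₀
  set C : ℝ≥0∞ := A ^ 3 + 2 * ν univ with hC
  have hCt : C ≠ ∞ := ENNReal.add_ne_top.2 ⟨ENNReal.pow_ne_top ENNReal.coe_ne_top,
    ENNReal.mul_ne_top ENNReal.ofNat_ne_top (measure_ne_top _ _)⟩
  set ε := ε₀ / C with hε
  obtain ⟨δ, hδ, hLeb⟩ := hz ε (ENNReal.div_pos hε₀.ne' hCt)
  obtain ⟨k₀, hk₀⟩ : ∃ k₀, ∀ k, k₀ ≤ k → 4 * s k < δ := by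
    have ht : Tendsto (fun k : ℕ => 4 * s k) atTop (𝓝 0) := by
      have h1 := (tendsto_pow_atTop_nhds_zero_of_lt_one (r := (1 / 2 : ℝ)) (by norm_num)
        (by norm_num)).const_mul (4 * s 0)
      rw [mul_zero] at h1
      refine h1.congr fun k => ?_
      rw [L.scale_eq k, one_div, inv_pow]
      ring
    exact eventually_atTop.1 (ht.eventually_lt_const hδ)
  have hρ := L.thickness_pos
  have hev : ∀ a : ℝ, 0 < a → ∀ᶠ r in 𝓝[>] (0 : ℝ), r < a := fun a ha =>
    mem_of_superset (Ioo_mem_nhdsGT ha) fun r hr => hr.2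
  filter_upwards [self_mem_nhdsWithin, hev (δ / 5) (by positivity),
    hev (ρ 0 / 2) (half_pos (hρ 0)), hev (ρ k₀ / 2) (half_pos (hρ k₀))] with r hr0 hrδ hrρ hrk
  have hr0' : 0 < r := hr0
  set B : Set Ω := Subtype.val ⁻¹' Metric.ball (z : X) r with hB
  have hBm : MeasurableSet B := measurable_subtype_coe Metric.isOpen_ball.measurableSet
  have hpoint : ∀ p ∈ B, ‖layeredExtension ν s c ρ f (p : X) - f z‖ₑ ≤ A ^ 3 * ε +
      ∑' k, (if s k < 2 * r then
        {p : Ω | Metric.infDist (p : X) (frontier Ω) < 2 * ρ k}.indicator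
          (fun _ => ENNReal.ofReal (M k) * (ε * ν univ)) p else 0) := by
    intro p hp
    have hpz : dist (p : X) z < r := hp
    have hdr : Metric.infDist (p : X) (frontier Ω) < r :=
      (Metric.infDist_le_dist_of_mem z.2).trans_lt hpz
    obtain ⟨K, w, hw1, hw, hle⟩ := L.exists_weights (f := f) hΩ h.nonempty p (by linarith) (f z)
    have hterm : ∀ k ∈ Finset.range K, w k * ‖smoothing ν (s k) (c k) f (p : X) - f z‖ₑ ≤
        w k * (A ^ 3 * ε) + (if s k < 2 * r then
          {p : Ω | Metric.infDist (p : X) (frontier Ω) < 2 * ρ k}.indicator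
            (fun _ => ENNReal.ofReal (M k) * (ε * ν univ)) p else 0) := by
      intro k hk
      by_cases hwk : w k = 0
      · rw [hwk, zero_mul, zero_mul]
        exact zero_le
      obtain ⟨hk1, hk2⟩ := hw k hwk
      have hwk1 : w k ≤ 1 := hw1 ▸ Finset.single_le_sum (f := w) (fun _ _ => zero_le) hk
      split_ifs with hsr
      · refine le_add_of_nonneg_of_le zero_le ?_
        rw [indicator_of_mem (show p ∈ {p : Ω | Metric.infDist (p : X) (frontier Ω) < 2 * ρ k}
          by rw [mem_ofPred_eq]; linarith [hρ k])]
        refine (mul_le_of_le_one_left zero_le hwk1).trans ?_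
        exact L.enorm_smoothing_sub_le_of_lt h hf hpz hsr hk1
          (hLeb _ (by linarith) (by linarith))
      · rw [add_zero]
        refine mul_le_mul_right (L.enorm_smoothing_sub_le_of_le h hf (by linarith) ?_) _
        refine hLeb _ (by linarith [L.scale_pos k]) (hk₀ k ?_)
        by_contra! hcon
        have := L.thickness_antitone (show k + 1 ≤ k₀ from hcon)
        linarith
    calc ‖layeredExtension ν s c ρ f (p : X) - f z‖ₑ
        ≤ ∑ k ∈ Finset.range K, w k * ‖smoothing ν (s k) (c k) f (p : X) - f z‖ₑ := hle
      _ ≤ _ := Finset.sum_le_sum hterm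
      _ ≤ _ := by
          rw [Finset.sum_add_distrib, ← Finset.sum_mul, hw1, one_mul]
          exact add_le_add le_rfl (ENNReal.sum_le_tsum _)
  have hint : ∫⁻ p in B, ‖layeredExtension ν s c ρ f (p : X) - f z‖ₑ ∂m ≤ ε * C * m B := by
    calc ∫⁻ p in B, ‖layeredExtension ν s c ρ f (p : X) - f z‖ₑ ∂m
        ≤ ∫⁻ p in B, (A ^ 3 * ε + ∑' k, (if s k < 2 * r then
            {p : Ω | Metric.infDist (p : X) (frontier Ω) < 2 * ρ k}.indicator
              (fun _ => ENNReal.ofReal (M k) * (ε * ν univ)) p else 0)) ∂m :=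
          setLIntegral_mono' hBm hpoint
      _ = A ^ 3 * ε * m B + ∑' k, ∫⁻ p in B, (if s k < 2 * r then
            {p : Ω | Metric.infDist (p : X) (frontier Ω) < 2 * ρ k}.indicator
              (fun _ => ENNReal.ofReal (M k) * (ε * ν univ)) p else 0) ∂m := by
          rw [lintegral_add_left measurable_const, setLIntegral_const, lintegral_tsum]
          intro k
          split_ifs
          · exact (measurable_const.indicator (measurableSet_layer _)).aemeasurable
          · exact aemeasurable_const
      _ ≤ A ^ 3 * ε * m B + ∑' k, 2⁻¹ ^ k * (m B * (ε * ν univ)) := by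
          refine add_le_add le_rfl (ENNReal.tsum_le_tsum fun k => ?_)
          split_ifs with hsr
          · refine (setLIntegral_le_lintegral _ _).trans ?_
            rw [lintegral_indicator_const (measurableSet_layer _), mul_right_comm,
              ← mul_assoc (2⁻¹ ^ k)]
            refine mul_le_mul_left ((L.layer_le_ball k z z.2).trans ?_) _
            refine mul_le_mul_right (measure_mono (preimage_mono (Metric.ball_subset_ball ?_))) _
            linarith
          · rw [lintegral_zero]
            exact zero_le
      _ = ε * C * m B := by
          rw [ENNReal.tsum_mul_right, tsum_inv_two_pow, hC]
          ring
  rw [setLAverage_eq]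
  refine ENNReal.div_le_of_le_mul (hint.trans ?_)
  gcongr
  rw [hε, mul_comm]
  exact ENNReal.mul_div_le

end Trace

/-! ### The extension operator -/

section Operator

variable {X : Type*} [MetricSpace X] [MeasurableSpace X] [BorelSpace X] {μ : Measure X} {Ω : Set X}

lemma bvNorm_congr_ae {Y : Type*} [MetricSpace Y] [MeasurableSpace Y] {m : Measure Y}
    {u v : Y → ℝ} (h : u =ᵐ[m] v) : bvNorm m u = bvNorm m v := by
  rw [bvNorm, bvNorm, eLpNorm_congr_ae h, totalVariation_congr_ae h]

omit [BorelSpace X] in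
lemma HasTraceAt.congr_ae {u v : Ω → ℝ} {z : X} {a : ℝ} (h : u =ᵐ[domainMeasure μ Ω] v)
    (hu : HasTraceAt μ Ω u z a) : HasTraceAt μ Ω v z a := by
  refine Tendsto.congr (fun r => ?_) hu
  rw [setLAverage_eq, setLAverage_eq]
  congr 1
  refine lintegral_congr_ae (ae_restrict_of_ae ?_)
  filter_upwards [h] with y hy
  rw [hy]

/-- The layered extension as a linear operator on `L¹(∂Ω)`. -/
lemma IsLayering.exists_linearMap {A : ℝ≥0} {D : ℝ} {s c ρ : ℕ → ℝ}
    (h : BoundaryEstimates μ Ω A D) (L : IsLayering μ Ω D s c ρ) (hΩ : IsOpen Ω) :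
    ∃ E : Lp ℝ 1 (boundaryMeasure μ Ω) →ₗ[ℝ] Lp ℝ 1 (domainMeasure μ Ω),
      ∀ f : Lp ℝ 1 (boundaryMeasure μ Ω),
      (fun p : Ω => layeredExtension (boundaryMeasure μ Ω) s c ρ f (p : X)) =ᵐ[domainMeasure μ Ω]
        E f := by
  have := h.isFinite_boundary
  have hint : ∀ f : Lp ℝ 1 (boundaryMeasure μ Ω), Integrable f (boundaryMeasure μ Ω) :=
    fun f => memLp_one_iff_integrable.1 (Lp.memLp f)
  have hmem := fun f : Lp ℝ 1 (boundaryMeasure μ Ω) => L.memLp h hΩ (hint f)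
  refine ⟨
    { toFun := fun f => (hmem f).toLp
      map_add' := fun f g => ?_
      map_smul' := fun a f => ?_ }, fun f => (hmem f).coeFn_toLp.symm⟩
  · rw [← MemLp.toLp_add, MemLp.toLp_eq_toLp_iff]
    refine Eventually.of_forall fun p => ?_
    simp only [layeredExtension_congr_ae (Lp.coeFn_add f g), Pi.add_apply]
    exact L.layeredExtension_add hΩ h.nonempty (hint f) (hint g) p
  · rw [RingHom.id_apply, ← MemLp.toLp_const_smul, MemLp.toLp_eq_toLp_iff]
    refine Eventually.of_forall fun p => ?_
    simp only [layeredExtension_congr_ae (Lp.coeFn_smul a f), Pi.smul_apply, smul_eq_mul]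
    exact L.layeredExtension_smul hΩ h.nonempty a p

lemma totalVariation_zero {Y : Type*} [MetricSpace Y] [MeasurableSpace Y] (m : Measure Y) :
    totalVariation m (0 : Y → ℝ) = 0 := by
  refine le_antisymm ((totalVariation_le_lintegral (g := 0) (LocallyLipschitz.const 0)
    MemLp.zero' ⟨measurable_const, fun a b γ _ _ _ => by simp⟩).trans (by simp)) zero_le

end Operator

end MetricBV

theorem theorem1p1 {X : Type*} [MetricSpace X] [CompleteSpace X] [MeasurableSpace X] [BorelSpace X]
    (μ : Measure X) (hμ : MetricBV.IsDoubling μ)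
    (Ω : Set X) (hΩo : IsOpen Ω) (hΩc : IsConnected Ω) (hΩb : Bornology.IsBounded Ω)
    (hreg : MetricBV.IsCodimOneAhlforsRegular μ Ω)
    (R : ℝ) (hR : 0 < R) :
    ∃ E : Lp ℝ 1 (MetricBV.boundaryMeasure μ Ω) →ₗ.[ℝ] Lp ℝ 1 (MetricBV.domainMeasure μ Ω),
      -- the domain of the linear operator `E` is exactly the Besov space
      (E.domain : Set (Lp ℝ 1 (MetricBV.boundaryMeasure μ Ω))) =
        MetricBV.besovSpace (MetricBV.boundaryMeasure μ Ω) 0 R ∧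
      -- `E` takes values in `BV(Ω)` and is bounded
      (∀ f : E.domain, E f ∈ MetricBV.bvSpace (MetricBV.domainMeasure μ Ω)) ∧
      (∃ C : ℝ≥0, ∀ f : E.domain,
        MetricBV.bvNorm (MetricBV.domainMeasure μ Ω) (E f) ≤
          C * MetricBV.besovNorm (MetricBV.boundaryMeasure μ Ω) 0 R
            (f : Lp ℝ 1 (MetricBV.boundaryMeasure μ Ω))) ∧
      -- the trace of `E f` exists `ℋ`-a.e. and equals `f`
      (∀ f : E.domain, MetricBV.HasTrace μ Ω (E f)
        (f : Lp ℝ 1 (MetricBV.boundaryMeasure μ Ω))) := by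
  open MetricBV in
  rcases (frontier Ω).eq_empty_or_nonempty with hempty | hne
  · have : IsEmpty (frontier Ω) := isEmpty_coe_sort.2 hempty
    have hν : boundaryMeasure μ Ω = 0 := Measure.eq_zero_of_isEmpty _
    have hE : totalVariation (domainMeasure μ Ω) (0 : Lp ℝ 1 (domainMeasure μ Ω)) = 0 := by
      rw [totalVariation_congr_ae (Lp.coeFn_zero ℝ 1 (domainMeasure μ Ω)), totalVariation_zero]
    refine ⟨⟨⊤, 0⟩, (eq_univ_of_forall fun f => ?_).symm, fun f => ?_, ⟨0, fun f => ?_⟩,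
      fun f => ?_⟩
    · change besovNorm _ 0 R f < ∞
      simp [besovNorm, besovEnergy, hν]
    · exact hE.trans_lt ENNReal.zero_lt_top
    · change bvNorm _ (0 : Lp ℝ 1 (domainMeasure μ Ω)) ≤ _
      rw [bvNorm, hE, eLpNorm_congr_ae (Lp.coeFn_zero ℝ 1 (domainMeasure μ Ω))]
      simp
    · exact Eventually.of_forall isEmptyElim
  · obtain ⟨A, D, h⟩ := exists_boundaryEstimates hμ hΩo hΩb hreg hne
    have := h.isFinite_boundary
    have := h.secondCountable
    obtain ⟨s, c, ρ, L, hs⟩ := h.exists_isLayering hΩo hR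
    obtain ⟨E, hE⟩ := L.exists_linearMap h hΩo
    have hint : ∀ f : Lp ℝ 1 (boundaryMeasure μ Ω), Integrable f (boundaryMeasure μ Ω) :=
      fun f => memLp_one_iff_integrable.1 (Lp.memLp f)
    have hbound : ∀ f : Lp ℝ 1 (boundaryMeasure μ Ω), bvNorm (domainMeasure μ Ω) (E f) ≤
        ((4 + 36 * A + 16 * A ^ 3 : ℝ≥0) : ℝ≥0∞) * besovNorm (boundaryMeasure μ Ω) 0 R f :=
      fun f => (bvNorm_congr_ae (hE f)).symm.trans_le
        (L.bvNorm_le h hΩo (Lp.stronglyMeasurable f).measurable (hint f) hs)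
    refine ⟨⟨besovSubmodule (boundaryMeasure μ Ω) R, E ∘ₗ Submodule.subtype _⟩, rfl, fun f => ?_,
      ⟨_, fun f => hbound f⟩, fun f => ?_⟩
    · exact (le_add_self.trans (hbound f)).trans_lt (ENNReal.mul_lt_top ENNReal.coe_lt_top f.2)
    · filter_upwards [h.ae_lebesgue_point (hint f)] with z hz
      exact (L.hasTraceAt h hΩo (hint f) hz).congr_ae (hE f)
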